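/- **Definitions.** An *abstract polyhedron* is a partially ordered set, ranked by elements of rank $0$ (vertices), rank $1$ (edges) and rank $2$ (faces), in which two elements are called *incident* if they are comparable, such that: (i) every edge is incident to exactly two vertices and exactly two faces; (ii) whenever a vertex is incident to a face, exactly two edges are incident to both; (iii) the incidence graph is connected; (iv) for each vertex or face $F$, the subgraph of the incidence graph induced on the neighbours of $F$ (excluding $F$) is connected. A *flag* is a triple of mutually incident vertex, edge and face; two flags are *adjacent* if they differ in exactly one element. An *automorphism* is an order isomorphism of the poset with itself. The polyhedron is *chiral* if its automorphism group is not transitive on flags, but the flags split into two classes such that the group acts transitively on each class and adjacent flags always lie in different classes. It has *type* $\{p,q\}$ if every face is a $p$-gon (is incident to exactly $p$ edges) and every vertex is incident to exactly $q$ edges. A polyhedron of type $\{p,q\}$ is *tight* if it has exactly $2pq$ flags. **Theorem.** Let $p$ and $q$ be positive integers satisfying at least one of the following conditions: 1. $q$ is odd, $p$ is an even divisor of $2q$, and there is an odd prime $m$ such that $m \mid p$ and $m^2 \mid q$; 2. $p$ and $q$ are both even, and there is an odd prime $m$ such that $m \mid p$ and $m^2 \mid q$; 3. $8 \mid p$ and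 $32 \mid q$. Then there exists a tight chiral polyhedron of type $\{p,q\}$, and there exists a tight chiral polyhedron of type $\{q,p\}$. -/

import Mathlib

universe u

/-- An abstract polyhedron: a ranked partially ordered set whose elements of rank `0`, `1`, `2` are
its vertices, edges and faces, subject to the four axioms at the end. The connectedness axioms
refer to the incidence graph, in which two distinct elements are joined when they are comparable. -/
structure AbstractPolyhedron where
  /-- The set of all vertices, edges and faces. -/
  carrier : Type u
  [order : PartialOrder carrier]
  rank : carrier → Fin 3
  rank_strictMono : StrictMono rank
  /-- Every edge is incident to exactly two vertices. -/
  edge_vertices : ∀ e, rank e = 1 → {v | rank v = 0 ∧ v ≤ e}.encard = 2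
  /-- Every edge is incident to exactly two faces. -/
  edge_faces : ∀ e, rank e = 1 → {f | rank f = 2 ∧ e ≤ f}.encard = 2
  /-- If a vertex is incident to a face, exactly two edges are incident to both. -/
  diamond : ∀ v f, rank v = 0 → rank f = 2 → v ≤ f →
    {e | rank e = 1 ∧ v ≤ e ∧ e ≤ f}.encard = 2
  /-- The incidence graph is connected. -/
  connected : (SimpleGraph.fromRel (fun x y : carrier => x ≤ y)).Connected
  /-- The neighbours of any vertex or face induce a connected subgraph of the incidence graph. -/
  link_connected : ∀ x, rank x = 0 ∨ rank x = 2 →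
    ((SimpleGraph.fromRel (fun x y : carrier => x ≤ y)).induce
      ((SimpleGraph.fromRel (fun x y : carrier => x ≤ y)).neighborSet x)).Connected

attribute [instance] AbstractPolyhedron.order

namespace AbstractPolyhedron

/-- A flag: a vertex, an edge and a face that are mutually incident. -/
@[ext]
structure Flag (P : AbstractPolyhedron.{u}) where
  vertex : P.carrier
  edge : P.carrier
  face : P.carrier
  rank_vertex : P.rank vertex = 0
  rank_edge : P.rank edge = 1
  rank_face : P.rank face = 2
  vertex_le_edge : vertex ≤ edge
  edge_le_face : edge ≤ face

/-- Two flags are adjacent if they differ in exactly one of their three elements. -/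
def Flag.Adjacent {P : AbstractPolyhedron.{u}} (Φ Ψ : P.Flag) : Prop :=
  (Φ.vertex ≠ Ψ.vertex ∧ Φ.edge = Ψ.edge ∧ Φ.face = Ψ.face) ∨
  (Φ.vertex = Ψ.vertex ∧ Φ.edge ≠ Ψ.edge ∧ Φ.face = Ψ.face) ∨
  (Φ.vertex = Ψ.vertex ∧ Φ.edge = Ψ.edge ∧ Φ.face ≠ Ψ.face)

/-- Some automorphism (order isomorphism of the poset with itself) sends the flag `Φ` to `Ψ`. -/
def Flag.Equivalent {P : AbstractPolyhedron.{u}} (Φ Ψ : P.Flag) : Prop :=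
  ∃ φ : P.carrier ≃o P.carrier,
    φ Φ.vertex = Ψ.vertex ∧ φ Φ.edge = Ψ.edge ∧ φ Φ.face = Ψ.face

/-- Regular: the automorphism group is transitive on the flags. -/
def IsRegular (P : AbstractPolyhedron.{u}) : Prop :=
  ∀ Φ Ψ : P.Flag, Φ.Equivalent Ψ

/-- Chiral: the automorphism group is not transitive on the flags, and the flags split into two
classes (`C` and its complement), on each of which the group acts transitively, such that adjacent
flags lie in different classes. -/
def IsChiral (P : AbstractPolyhedron.{u}) : Prop :=
  ¬ P.IsRegular ∧ ∃ C : Set P.Flag,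
    (∀ Φ Ψ : P.Flag, Φ.Equivalent Ψ ↔ (Φ ∈ C ↔ Ψ ∈ C)) ∧
    (∀ Φ Ψ : P.Flag, Φ.Adjacent Ψ → (Φ ∈ C ↔ Ψ ∉ C))

/-- Schläfli symbol `{p, q}`: every face is a `p`-gon (it is incident to `p` edges) and every
vertex-figure is a `q`-gon (every vertex is incident to `q` edges). -/
def HasType (P : AbstractPolyhedron.{u}) (p q : ℕ) : Prop :=
  (∀ f, P.rank f = 2 → {e | P.rank e = 1 ∧ e ≤ f}.encard = p) ∧
  (∀ v, P.rank v = 0 → {e | P.rank e = 1 ∧ v ≤ e}.encard = q)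

/-- A tight polyhedron of type `{p, q}`: it has type `{p, q}` and exactly `2pq` flags. -/
def IsTightOfType (P : AbstractPolyhedron.{u}) (p q : ℕ) : Prop :=
  P.HasType p q ∧ ENat.card P.Flag = 2 * p * q

end AbstractPolyhedron

/-! Suppose `G = ⟨x⟩⟨y⟩` has order `pq`, where `x`, `y` have orders `p`, `q`, `(xy)² = 1` and `⟨x⟩ ∩
⟨y⟩ = 1`. Cosets of `⟨y⟩`, `⟨xy⟩`, `⟨x⟩`, incident when they meet, form a tight polyhedron whose
flags are two copies of `G`, each permuted transitively by left translation. An automorphism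
exchanging the copies would induce an endomorphism of `G` with `y ↦ y⁻¹`, `xy ↦ xy`; followed by
conjugation by `y`, it inverts both generators. So chirality follows from a relation that holds for
`(x, y)` and fails for `(x⁻¹, y⁻¹)` (`isChiral_polyhedron`, `irreversible_of_commRel`).

Such a relation comes from nilpotency class two. Let `a`, `b` have orders `q`, `r` and central
commutator `a^K b^L`, and let `t` be an involution with `a^t = a⁻¹b`. Then `y = a`, `x = t a⁻¹`
satisfy `xy = t`, `x² = b⁻¹`, and have type `{2r, q}`. The commutator of `x^(2S)` and `y^S` is
bilinear, hence unchanged when both generators are inverted, whereas its expression `y^M x^(2N)` is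
inverted. The two are incompatible once `2S²K ≠ 0` modulo `q` (`not_commRel_inv`). The commutator is
taken of order `n`, with `K = q/n`: an odd prime `n = m` works when `m² ∣ q`, and `n = 4` works when
`32 ∣ q`; `n = 2` is useless because then `2K = q`.

The first condition is covered directly. In the other two, the `m`-part or `2`-part of the type is
realised this way and mixed (a fibre product over an abelian quotient, `exists_mix`) with a pair
built from dihedral groups; `S` is chosen to trivialise the relation in that second factor.
Replacing `(x, y)` by `(y⁻¹, x⁻¹)` reverses the type. -/

/-- A pair of elements of a finite group that behaves like the standard generators of the rotation
group of a tight polyhedron of type `{p, q}`. -/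
structure TightRotary {G : Type*} [Group G] (x y : G) (p q : ℕ) : Prop where
  orderOf_left : orderOf x = p
  orderOf_right : orderOf y = q
  sq_mul : (x * y) ^ 2 = 1
  disjoint : Disjoint (Subgroup.zpowers x) (Subgroup.zpowers y)
  card : Nat.card G = p * q

namespace TightRotary

variable {G : Type*} [Group G] {x y : G} {p q : ℕ}

theorem eq_one_of_mem (h : TightRotary x y p q) {g : G} (hx : g ∈ Subgroup.zpowers x)
    (hy : g ∈ Subgroup.zpowers y) : g = 1 :=
  Subgroup.disjoint_def.mp h.disjoint hx hy

/-- Trivial intersection and the order `p * q` make the two cyclic subgroups complementary. -/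
theorem exists_pow_mul_pow (h : TightRotary x y p q) (hp : 0 < p) (hq : 0 < q) (g : G) :
    ∃ i j : ℕ, g = x ^ i * y ^ j := by
  have hf : Finite G := Nat.finite_of_card_ne_zero (by rw [h.card]; positivity)
  have hc : Subgroup.IsComplement' (Subgroup.zpowers x) (Subgroup.zpowers y) :=
    Subgroup.isComplement'_of_card_mul_and_disjoint
      (by rw [Nat.card_zpowers, Nat.card_zpowers, h.orderOf_left, h.orderOf_right, h.card])
      h.disjoint
  obtain ⟨⟨⟨a, ha⟩, ⟨b, hb⟩⟩, hab⟩ := hc.surjective g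
  obtain ⟨i, rfl⟩ := (mem_powers_iff_mem_zpowers.mpr ha)
  obtain ⟨j, rfl⟩ := (mem_powers_iff_mem_zpowers.mpr hb)
  exact ⟨i, j, hab.symm⟩

theorem mul_mul_mul (h : TightRotary x y p q) : x * y * (x * y) = 1 := by
  rw [← pow_two, h.sq_mul]

theorem mul_inv_eq (h : TightRotary x y p q) : (x * y)⁻¹ = x * y :=
  inv_eq_of_mul_eq_one_left h.mul_mul_mul

theorem dual (h : TightRotary x y p q) : TightRotary y⁻¹ x⁻¹ q p where
  orderOf_left := by rw [orderOf_inv, h.orderOf_right]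
  orderOf_right := by rw [orderOf_inv, h.orderOf_left]
  sq_mul := by rw [← mul_inv_rev, inv_pow, h.sq_mul, inv_one]
  disjoint := by rw [Subgroup.zpowers_inv, Subgroup.zpowers_inv]; exact h.disjoint.symm
  card := by rw [h.card, mul_comm]

end TightRotary

/-! ### The coset geometry of a tight rotary pair -/

/-- The elements of the coset geometry of a pair of group elements: cosets of the cyclic subgroups
generated by `y`, `x * y` and `x`. -/
inductive CosetElt {G : Type*} [Group G] (x y : G) : Type _
  | vertex (v : G ⧸ Subgroup.zpowers y)
  | edge (e : G ⧸ Subgroup.zpowers (x * y))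
  | face (f : G ⧸ Subgroup.zpowers x)

namespace CosetElt

variable {G : Type*} [Group G] {x y : G} {p q : ℕ}

/-- The vertex of a group element. -/
def V (x y g : G) : CosetElt x y := vertex (QuotientGroup.mk g)

/-- The edge of a group element. -/
def E (x y g : G) : CosetElt x y := edge (QuotientGroup.mk g)

/-- The face of a group element. -/
def F (x y g : G) : CosetElt x y := face (QuotientGroup.mk g)

/-- Vertices, edges and faces have rank `0`, `1` and `2`. -/
def rank : CosetElt x y → Fin 3
  | vertex _ => 0
  | edge _ => 1
  | face _ => 2

theorem exists_V {v : CosetElt x y} (h : rank v = 0) : ∃ g, v = V x y g := by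
  rcases v with v | v | v
  · obtain ⟨g, rfl⟩ := QuotientGroup.mk_surjective v
    exact ⟨g, rfl⟩
  · simp [rank] at h
  · simp [rank] at h

theorem exists_E {v : CosetElt x y} (h : rank v = 1) : ∃ g, v = E x y g := by
  rcases v with v | v | v
  · simp [rank] at h
  · obtain ⟨g, rfl⟩ := QuotientGroup.mk_surjective v
    exact ⟨g, rfl⟩
  · simp [rank] at h

theorem exists_F {v : CosetElt x y} (h : rank v = 2) : ∃ g, v = F x y g := by
  rcases v with v | v | v
  · simp [rank] at h
  · simp [rank] at h
  · obtain ⟨g, rfl⟩ := QuotientGroup.mk_surjective v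
    exact ⟨g, rfl⟩

theorem V_eq_V {g h : G} : V x y g = V x y h ↔ g⁻¹ * h ∈ Subgroup.zpowers y := by
  simp only [V, vertex.injEq]; exact QuotientGroup.eq

theorem E_eq_E {g h : G} : E x y g = E x y h ↔ g⁻¹ * h ∈ Subgroup.zpowers (x * y) := by
  simp only [E, edge.injEq]; exact QuotientGroup.eq

theorem F_eq_F {g h : G} : F x y g = F x y h ↔ g⁻¹ * h ∈ Subgroup.zpowers x := by
  simp only [F, face.injEq]; exact QuotientGroup.eq

theorem mem_zpowers_involution (h : TightRotary x y p q) {g : G} :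
    g ∈ Subgroup.zpowers (x * y) ↔ g = 1 ∨ g = x * y := by
  constructor
  · rintro ⟨n, rfl⟩
    rcases Int.even_or_odd' n with ⟨k, rfl | rfl⟩
    · left
      have : (x * y) ^ (2 : ℤ) = 1 := by exact_mod_cast h.sq_mul
      simp only [zpow_mul, this, one_zpow]
    · right
      have : (x * y) ^ (2 : ℤ) = 1 := by exact_mod_cast h.sq_mul
      simp only [zpow_add, zpow_mul, this, one_zpow, one_mul, zpow_one]
  · rintro (rfl | rfl)
    · exact one_mem _
    · exact Subgroup.mem_zpowers _

theorem E_eq_E_iff (h : TightRotary x y p q) {g k : G} :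
    E x y g = E x y k ↔ k = g ∨ k = g * (x * y) := by
  rw [E_eq_E, mem_zpowers_involution h, inv_mul_eq_one, inv_mul_eq_iff_eq_mul, eq_comm]

theorem E_mul (h : TightRotary x y p q) (g : G) : E x y (g * (x * y)) = E x y g :=
  ((E_eq_E_iff h).mpr (Or.inr rfl)).symm

theorem V_mul_zpow (g : G) (n : ℤ) : V x y (g * y ^ n) = V x y g :=
  (V_eq_V.mpr (by simp [Subgroup.zpow_mem_zpowers])).symm

theorem F_mul_zpow (g : G) (n : ℤ) : F x y (g * x ^ n) = F x y g :=
  (F_eq_F.mpr (by simp [Subgroup.zpow_mem_zpowers])).symm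

theorem V_mul (g : G) : V x y (g * (x * y)) = V x y (g * x) := by
  simpa [mul_assoc] using V_mul_zpow (x := x) (y := y) (g * x) 1

theorem F_mul (h : TightRotary x y p q) (g : G) : F x y (g * (x * y)) = F x y (g * y⁻¹) := by
  rw [← h.mul_inv_eq]
  simpa [mul_assoc] using F_mul_zpow (x := x) (y := y) (g * y⁻¹) (-1)

theorem mul_notMem_left (h : TightRotary x y p q) (hy : y ≠ 1) :
    x * y ∉ Subgroup.zpowers x := fun hm => hy <|
  h.eq_one_of_mem ((Subgroup.mul_mem_cancel_left _ (Subgroup.mem_zpowers x)).mp hm)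
    (Subgroup.mem_zpowers y)

theorem mul_notMem_right (h : TightRotary x y p q) (hx : x ≠ 1) :
    x * y ∉ Subgroup.zpowers y := fun hm => hx <|
  h.eq_one_of_mem (Subgroup.mem_zpowers x)
    ((Subgroup.mul_mem_cancel_right _ (Subgroup.mem_zpowers y)).mp hm)

/-- Cosets of two subgroups with trivial intersection share at most one element. -/
theorem eq_of_V_of_F (h : TightRotary x y p q) {g k : G} (hV : V x y g = V x y k)
    (hF : F x y g = F x y k) : g = k :=
  inv_mul_eq_one.mp (h.eq_one_of_mem (F_eq_F.mp hF) (V_eq_V.mp hV))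

theorem eq_of_V_of_E (h : TightRotary x y p q) (hx : x ≠ 1) {g k : G}
    (hV : V x y g = V x y k) (hE : E x y g = E x y k) : g = k := by
  rcases (E_eq_E_iff h).mp hE with hk | hk
  · exact hk.symm
  · rw [V_eq_V, hk, inv_mul_cancel_left] at hV
    exact absurd hV (mul_notMem_right h hx)

theorem eq_of_E_of_F (h : TightRotary x y p q) (hy : y ≠ 1) {g k : G}
    (hE : E x y g = E x y k) (hF : F x y g = F x y k) : g = k := by
  rcases (E_eq_E_iff h).mp hE with hk | hk
  · exact hk.symm
  · rw [F_eq_F, hk, inv_mul_cancel_left] at hF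
    exact absurd hF (mul_notMem_left h hy)

/-- Two elements are comparable when the cosets meet. -/
protected def le : CosetElt x y → CosetElt x y → Prop
  | vertex v, vertex w => v = w
  | vertex v, edge e => ∃ g : G, v = QuotientGroup.mk g ∧ e = QuotientGroup.mk g
  | vertex v, face f => ∃ g : G, v = QuotientGroup.mk g ∧ f = QuotientGroup.mk g
  | edge d, edge e => d = e
  | edge e, face f => ∃ g : G, e = QuotientGroup.mk g ∧ f = QuotientGroup.mk g
  | face f, face k => f = k
  | _, _ => False

theorem le_trans_of_tightRotary (h : TightRotary x y p q) {a b c : CosetElt x y}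
    (hab : a.le b) (hbc : b.le c) : a.le c := by
  rcases a with a | a | a <;> rcases b with b | b | b <;> rcases c with c | c | c <;>
    simp only [CosetElt.le] at hab hbc ⊢ <;> try (subst hab; exact hbc)
  all_goals try (subst hbc; exact hab)
  obtain ⟨g, rfl, hg⟩ := hab
  obtain ⟨k, rfl, rfl⟩ := hbc
  have hE : E x y g = E x y k := by rw [E, E, hg]
  rcases (E_eq_E_iff h).mp hE with rfl | rfl
  · exact ⟨_, rfl, rfl⟩
  -- Vertex and face meet the edge coset in different elements. Since `x * y` is an involution, `g *
  -- y⁻¹` lies in the face coset of `g * (x * y)`, and it stays in the vertex coset of `g`.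
  · refine ⟨g * y⁻¹, ?_, ?_⟩
    · simp
    · exact face.inj (F_mul h g)

/-- The incidence order of the coset geometry. -/
@[reducible] def partialOrder (h : TightRotary x y p q) : PartialOrder (CosetElt x y) where
  le := CosetElt.le
  le_refl a := by rcases a with a | a | a <;> rfl
  le_trans _ _ _ := le_trans_of_tightRotary h
  le_antisymm a b hab hba := by
    rcases a with a | a | a <;> rcases b with b | b | b <;>
      simp only [CosetElt.le] at hab hba <;> rw [hab]

end CosetElt

namespace CosetElt

variable {G : Type*} [Group G] {x y : G} {p q : ℕ}

theorem V_le_E_iff (h : TightRotary x y p q) {g k : G} :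
    (V x y g).le (E x y k) ↔ V x y g = V x y k ∨ V x y g = V x y (k * (x * y)) := by
  constructor
  · rintro ⟨m, hv, he⟩
    rcases (E_eq_E_iff h).mp (show E x y k = E x y m from congrArg edge he) with rfl | rfl
    · exact Or.inl (congrArg vertex hv)
    · exact Or.inr (congrArg vertex hv)
  · rintro (hv | hv)
    · exact ⟨k, vertex.inj hv, rfl⟩
    · exact ⟨_, vertex.inj hv, (edge.inj (E_mul h k)).symm⟩

theorem E_le_F_iff (h : TightRotary x y p q) {g k : G} :
    (E x y k).le (F x y g) ↔ F x y g = F x y k ∨ F x y g = F x y (k * (x * y)) := by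
  constructor
  · rintro ⟨m, he, hv⟩
    rcases (E_eq_E_iff h).mp (show E x y k = E x y m from congrArg edge he) with rfl | rfl
    · exact Or.inl (congrArg face hv)
    · exact Or.inr (congrArg face hv)
  · rintro (hv | hv)
    · exact ⟨k, rfl, face.inj hv⟩
    · exact ⟨_, (edge.inj (E_mul h k)).symm, face.inj hv⟩

theorem V_le_F_iff {g k : G} :
    (V x y g).le (F x y k) ↔ ∃ m, V x y g = V x y m ∧ F x y k = F x y m :=
  ⟨fun ⟨m, hv, hf⟩ => ⟨m, congrArg vertex hv, congrArg face hf⟩,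
    fun ⟨m, hv, hf⟩ => ⟨m, vertex.inj hv, face.inj hf⟩⟩

theorem V_le_E (g : G) : (V x y g).le (E x y g) := ⟨g, rfl, rfl⟩

theorem E_le_F (g : G) : (E x y g).le (F x y g) := ⟨g, rfl, rfl⟩

theorem V_le_F (g : G) : (V x y g).le (F x y g) := ⟨g, rfl, rfl⟩

theorem mem_zpowers_iff_exists_pow {z g : G} (hz : 0 < orderOf z) :
    g ∈ Subgroup.zpowers z ↔ ∃ n : ℕ, g = z ^ n := by
  rw [← (orderOf_pos_iff.mp hz).mem_powers_iff_mem_zpowers]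
  exact ⟨fun ⟨n, hn⟩ => ⟨n, hn.symm⟩, fun ⟨n, hn⟩ => ⟨n, hn.symm⟩⟩

theorem rank_lt_of_le {a b : CosetElt x y} (h : a.le b) (hne : a ≠ b) : rank a < rank b := by
  rcases a with a | a | a <;> rcases b with b | b | b <;> simp only [CosetElt.le] at h
  all_goals first | exact absurd (congrArg _ h) hne | simp [rank]

/-- Represent the edge by an element `k` of the vertex coset. The face contains either `k`, forcing
`k = g`, or `k * (x * y)` and hence `k * y⁻¹`, forcing `k = g * y`. -/
theorem edges_between (h : TightRotary x y p q) (g : G) :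
    {e | rank e = 1 ∧ (V x y g).le e ∧ e.le (F x y g)} = {E x y g, E x y (g * y)} := by
  ext e
  simp only [Set.mem_ofPred_eq, Set.mem_insert_iff, Set.mem_singleton_iff]
  constructor
  · rintro ⟨he, hv, hf⟩
    obtain ⟨k, hk, rfl⟩ : ∃ k, V x y g = V x y k ∧ e = E x y k := by
      obtain ⟨k, rfl⟩ := exists_E he
      rcases (V_le_E_iff h).mp hv with hv | hv
      · exact ⟨k, hv, rfl⟩
      · exact ⟨_, hv, (E_mul h k).symm⟩
    rcases (E_le_F_iff h).mp hf with hf | hf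
    · rw [eq_of_V_of_F h hk hf]
      exact Or.inl rfl
    · rw [F_mul h] at hf
      have hV : V x y g = V x y (k * y⁻¹) := by
        rw [hk]; simpa using (V_mul_zpow (x := x) (y := y) k (-1)).symm
      rw [eq_of_V_of_F h hV hf]
      exact Or.inr (by simp)
  · rintro (rfl | rfl)
    · exact ⟨rfl, V_le_E g, E_le_F g⟩
    · refine ⟨rfl, (V_le_E_iff h).mpr (Or.inl ?_), (E_le_F_iff h).mpr (Or.inr ?_)⟩
      · simpa using (V_mul_zpow (x := x) (y := y) g 1).symm
      · rw [F_mul h]; simp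

theorem vertices_of_edge (h : TightRotary x y p q) (g : G) :
    {v | rank v = 0 ∧ v.le (E x y g)} = {V x y g, V x y (g * (x * y))} := by
  ext v
  simp only [Set.mem_ofPred_eq, Set.mem_insert_iff, Set.mem_singleton_iff]
  constructor
  · rintro ⟨hv, hle⟩
    obtain ⟨k, rfl⟩ := exists_V hv
    exact (V_le_E_iff h).mp hle
  · intro hv
    obtain ⟨k, rfl⟩ : ∃ k, v = V x y k := by rcases hv with rfl | rfl <;> exact ⟨_, rfl⟩
    exact ⟨rfl, (V_le_E_iff h).mpr hv⟩

theorem faces_of_edge (h : TightRotary x y p q) (g : G) :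
    {f | rank f = 2 ∧ (E x y g).le f} = {F x y g, F x y (g * (x * y))} := by
  ext v
  simp only [Set.mem_ofPred_eq, Set.mem_insert_iff, Set.mem_singleton_iff]
  constructor
  · rintro ⟨hv, hle⟩
    obtain ⟨k, rfl⟩ := exists_F hv
    exact (E_le_F_iff h).mp hle
  · intro hv
    obtain ⟨k, rfl⟩ : ∃ k, v = F x y k := by rcases hv with rfl | rfl <;> exact ⟨_, rfl⟩
    exact ⟨rfl, (E_le_F_iff h).mpr hv⟩

theorem V_ne_V_mul (h : TightRotary x y p q) (hx : x ≠ 1) (g : G) :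
    V x y g ≠ V x y (g * (x * y)) := by
  rw [Ne, V_eq_V, inv_mul_cancel_left]
  exact mul_notMem_right h hx

theorem F_ne_F_mul (h : TightRotary x y p q) (hy : y ≠ 1) (g : G) :
    F x y g ≠ F x y (g * (x * y)) := by
  rw [Ne, F_eq_F, inv_mul_cancel_left]
  exact mul_notMem_left h hy

theorem edges_of_vertex (h : TightRotary x y p q) (g : G) :
    {e | rank e = 1 ∧ (V x y g).le e} =
      (fun z => E x y (g * z)) '' (Subgroup.zpowers y : Set G) := by
  ext e
  simp only [Set.mem_ofPred_eq, Set.mem_image, SetLike.mem_coe]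
  constructor
  · rintro ⟨he, hle⟩
    obtain ⟨k, rfl⟩ := exists_E he
    rcases (V_le_E_iff h).mp hle with hk | hk
    · exact ⟨g⁻¹ * k, V_eq_V.mp hk, by simp⟩
    · exact ⟨g⁻¹ * (k * (x * y)), V_eq_V.mp hk, by rw [mul_inv_cancel_left, E_mul h]⟩
  · rintro ⟨z, hz, rfl⟩
    refine ⟨rfl, (V_le_E_iff h).mpr (Or.inl (V_eq_V.mpr ?_))⟩
    rwa [inv_mul_cancel_left]

theorem edges_of_face (h : TightRotary x y p q) (g : G) :
    {e | rank e = 1 ∧ e.le (F x y g)} =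
      (fun z => E x y (g * z)) '' (Subgroup.zpowers x : Set G) := by
  ext e
  simp only [Set.mem_ofPred_eq, Set.mem_image, SetLike.mem_coe]
  constructor
  · rintro ⟨he, hle⟩
    obtain ⟨k, rfl⟩ := exists_E he
    rcases (E_le_F_iff h).mp hle with hk | hk
    · exact ⟨g⁻¹ * k, F_eq_F.mp hk, by simp⟩
    · exact ⟨g⁻¹ * (k * (x * y)), F_eq_F.mp hk, by rw [mul_inv_cancel_left, E_mul h]⟩
  · rintro ⟨z, hz, rfl⟩
    refine ⟨rfl, (E_le_F_iff h).mpr (Or.inl (F_eq_F.mpr ?_))⟩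
    rwa [inv_mul_cancel_left]

theorem encard_zpowers {z : G} (hz : 0 < orderOf z) :
    (Subgroup.zpowers z : Set G).encard = orderOf z := by
  have : Finite (Subgroup.zpowers z) :=
    Nat.finite_of_card_ne_zero (by rw [Nat.card_zpowers]; omega)
  rw [← Set.Finite.cast_ncard_eq (Set.toFinite _), ← Nat.card_coe_set_eq]
  exact congrArg _ (Nat.card_zpowers z)

theorem encard_edges_of_vertex (h : TightRotary x y p q) (hx : x ≠ 1) (hq : 0 < q) (g : G) :
    {e | rank e = 1 ∧ (V x y g).le e}.encard = q := by
  rw [edges_of_vertex h, Set.InjOn.encard_image, encard_zpowers, h.orderOf_right]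
  · rwa [h.orderOf_right]
  · intro a ha b hb hab
    refine mul_left_cancel (eq_of_V_of_E h hx ?_ hab)
    rw [V_eq_V, mul_inv_rev, mul_assoc, inv_mul_cancel_left]
    exact mul_mem (inv_mem ha) hb

theorem encard_edges_of_face (h : TightRotary x y p q) (hy : y ≠ 1) (hp : 0 < p) (g : G) :
    {e | rank e = 1 ∧ e.le (F x y g)}.encard = p := by
  rw [edges_of_face h, Set.InjOn.encard_image, encard_zpowers, h.orderOf_left]
  · rwa [h.orderOf_left]
  · intro a ha b hb hab
    refine mul_left_cancel (eq_of_E_of_F h hy hab ?_)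
    rw [F_eq_F, mul_inv_rev, mul_assoc, inv_mul_cancel_left]
    exact mul_mem (inv_mem ha) hb

/-- The incidence graph of the coset geometry. -/
def graph (x y : G) : SimpleGraph (CosetElt x y) := SimpleGraph.fromRel CosetElt.le

theorem V_adj_E {g : G} : (graph x y).Adj (V x y g) (E x y g) :=
  (SimpleGraph.fromRel_adj _ _ _).mpr ⟨by simp [V, E], Or.inl (V_le_E g)⟩

theorem V_adj_F {g : G} : (graph x y).Adj (V x y g) (F x y g) :=
  (SimpleGraph.fromRel_adj _ _ _).mpr ⟨by simp [V, F], Or.inl (V_le_F g)⟩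

theorem E_adj_F {g : G} : (graph x y).Adj (E x y g) (F x y g) :=
  (SimpleGraph.fromRel_adj _ _ _).mpr ⟨by simp [E, F], Or.inl (E_le_F g)⟩

theorem graph_connected (h : TightRotary x y p q) (hp : 0 < p) (hq : 0 < q) :
    (graph x y).Connected := by
  have key : ∀ a, (graph x y).Reachable (V x y 1) a := by
    have hV : ∀ g, (graph x y).Reachable (V x y 1) (V x y g) := by
      intro g
      obtain ⟨i, j, rfl⟩ := h.exists_pow_mul_pow hp hq g
      -- Every vertex lies on the face of `1`: dropping the power of `y` leaves a power of `x`.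
      rw [← zpow_natCast y, V_mul_zpow]
      have h1 : F x y 1 = F x y (x ^ i) := by
        simpa using (F_mul_zpow (x := x) (y := y) 1 i).symm
      exact (h1 ▸ V_adj_F.reachable).trans V_adj_F.symm.reachable
    rintro (a | a | a) <;> obtain ⟨g, rfl⟩ := QuotientGroup.mk_surjective a
    · exact hV g
    · exact (hV g).trans V_adj_E.reachable
    · exact (hV g).trans V_adj_F.reachable
  exact (SimpleGraph.connected_iff_exists_forall_reachable _).mpr ⟨_, key⟩

/-- The neighbours are traversed by the walk through the edge and face of `g`, then those of `g *
y`, `g * y ^ 2`, and so on: the face of `g * y ^ n` also lies on the edge of `g * y ^ (n + 1)`. -/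
theorem link_vertex_connected (h : TightRotary x y p q) (hq : 0 < q) (g : G) :
    ((graph x y).induce ((graph x y).neighborSet (V x y g))).Connected := by
  have hV : ∀ n : ℕ, V x y (g * y ^ n) = V x y g := fun n => by
    rw [← zpow_natCast y, V_mul_zpow]
  have hE : ∀ n : ℕ, E x y (g * y ^ n) ∈ (graph x y).neighborSet (V x y g) := fun n => by
    rw [← hV n]; exact V_adj_E
  have hF : ∀ n : ℕ, F x y (g * y ^ n) ∈ (graph x y).neighborSet (V x y g) := fun n => by
    rw [← hV n]; exact V_adj_F
  have hEF : ∀ n, ((graph x y).induce ((graph x y).neighborSet (V x y g))).Adj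
      ⟨_, hE n⟩ ⟨_, hF n⟩ := fun n => E_adj_F
  have hFE : ∀ n, ((graph x y).induce ((graph x y).neighborSet (V x y g))).Adj
      ⟨_, hF n⟩ ⟨_, hE (n + 1)⟩ := fun n => by
    refine SimpleGraph.Adj.symm ((SimpleGraph.fromRel_adj _ _ _).mpr ⟨by simp [E, F], Or.inl ?_⟩)
    refine (E_le_F_iff h).mpr (Or.inr ?_)
    rw [F_mul h, pow_succ, ← mul_assoc, mul_inv_cancel_right]
  have hr : ∀ n, ((graph x y).induce ((graph x y).neighborSet (V x y g))).Reachable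
      ⟨_, hE 0⟩ ⟨_, hE n⟩ := fun n => by
    induction n with
    | zero => exact SimpleGraph.Reachable.rfl
    | succ n ih => exact ih.trans ((hEF n).reachable.trans (hFE n).reachable)
  refine (SimpleGraph.connected_iff_exists_forall_reachable _).mpr ⟨⟨_, hE 0⟩, ?_⟩
  have hz : 0 < orderOf y := by rwa [h.orderOf_right]
  rintro ⟨a, ha⟩
  have ha' := (SimpleGraph.fromRel_adj _ _ _).mp ha
  rcases a with a | a | a <;> obtain ⟨k, rfl⟩ := QuotientGroup.mk_surjective a
  · exact absurd (ha'.2.elim (congrArg vertex) fun hle => congrArg vertex hle.symm) ha'.1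
  · have hle : (V x y g).le (E x y k) := ha'.2.resolve_right id
    obtain ⟨n, hn⟩ : ∃ n : ℕ, E x y k = E x y (g * y ^ n) := by
      have := (edges_of_vertex h g).subset ⟨rfl, hle⟩
      obtain ⟨z, hz', hzk⟩ := this
      obtain ⟨n, rfl⟩ := (mem_zpowers_iff_exists_pow hz).mp hz'
      exact ⟨n, hzk.symm⟩
    have := hr n
    simp only [← hn] at this
    exact this
  · have hle : (V x y g).le (F x y k) := ha'.2.resolve_right id
    obtain ⟨n, hn⟩ : ∃ n : ℕ, F x y k = F x y (g * y ^ n) := by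
      obtain ⟨m, hm, hk⟩ := V_le_F_iff.mp hle
      obtain ⟨n, hn⟩ := (mem_zpowers_iff_exists_pow hz).mp (V_eq_V.mp hm)
      exact ⟨n, by rw [hk, ← hn, mul_inv_cancel_left]⟩
    have := (hr n).trans (hEF n).reachable
    simp only [← hn] at this
    exact this

theorem link_face_connected (h : TightRotary x y p q) (hp : 0 < p) (g : G) :
    ((graph x y).induce ((graph x y).neighborSet (F x y g))).Connected := by
  have hV' : ∀ n : ℕ, F x y (g * x ^ n) = F x y g := fun n => by
    rw [← zpow_natCast x, F_mul_zpow]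
  have hE : ∀ n : ℕ, E x y (g * x ^ n) ∈ (graph x y).neighborSet (F x y g) := fun n => by
    rw [← hV' n]; exact E_adj_F.symm
  have hV : ∀ n : ℕ, V x y (g * x ^ n) ∈ (graph x y).neighborSet (F x y g) := fun n => by
    rw [← hV' n]; exact V_adj_F.symm
  have hVE : ∀ n, ((graph x y).induce ((graph x y).neighborSet (F x y g))).Adj
      ⟨_, hV n⟩ ⟨_, hE n⟩ := fun n => V_adj_E
  have hEV : ∀ n, ((graph x y).induce ((graph x y).neighborSet (F x y g))).Adj
      ⟨_, hE n⟩ ⟨_, hV (n + 1)⟩ := fun n => by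
    refine SimpleGraph.Adj.symm ((SimpleGraph.fromRel_adj _ _ _).mpr ⟨by simp [E, V], Or.inl ?_⟩)
    refine (V_le_E_iff h).mpr (Or.inr ?_)
    rw [V_mul, pow_succ, mul_assoc]
  have hr : ∀ n, ((graph x y).induce ((graph x y).neighborSet (F x y g))).Reachable
      ⟨_, hE 0⟩ ⟨_, hE n⟩ := fun n => by
    induction n with
    | zero => exact SimpleGraph.Reachable.rfl
    | succ n ih => exact ih.trans ((hEV n).reachable.trans (hVE (n + 1)).reachable)
  refine (SimpleGraph.connected_iff_exists_forall_reachable _).mpr ⟨⟨_, hE 0⟩, ?_⟩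
  have hz : 0 < orderOf x := by rwa [h.orderOf_left]
  rintro ⟨a, ha⟩
  have ha' := (SimpleGraph.fromRel_adj _ _ _).mp ha
  rcases a with a | a | a <;> obtain ⟨k, rfl⟩ := QuotientGroup.mk_surjective a
  · have hle : (V x y k).le (F x y g) := ha'.2.resolve_left id
    obtain ⟨n, hn⟩ : ∃ n : ℕ, V x y k = V x y (g * x ^ n) := by
      obtain ⟨m, hm, hk⟩ := V_le_F_iff.mp hle
      obtain ⟨n, hn⟩ := (mem_zpowers_iff_exists_pow hz).mp (F_eq_F.mp hk)
      exact ⟨n, by rw [hm, ← hn, mul_inv_cancel_left]⟩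
    have := (hr n).trans (hVE n).symm.reachable
    simp only [← hn] at this
    exact this
  · have hle : (E x y k).le (F x y g) := ha'.2.resolve_left id
    obtain ⟨n, hn⟩ : ∃ n : ℕ, E x y k = E x y (g * x ^ n) := by
      have := (edges_of_face h g).subset ⟨rfl, hle⟩
      obtain ⟨z, hz', hzk⟩ := this
      obtain ⟨n, rfl⟩ := (mem_zpowers_iff_exists_pow hz).mp hz'
      exact ⟨n, hzk.symm⟩
    have := hr n
    simp only [← hn] at this
    exact this
  · exact absurd (ha'.2.elim (congrArg face) fun hle => congrArg face hle.symm) ha'.1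

end CosetElt

open CosetElt in
/-- The coset geometry of a tight rotary pair is an abstract polyhedron. -/
def TightRotary.polyhedron {G : Type*} [Group G] {x y : G} {p q : ℕ}
    (h : TightRotary x y p q) (hp : 1 < p) (hq : 1 < q) : AbstractPolyhedron where
  carrier := CosetElt x y
  order := partialOrder h
  rank := rank
  rank_strictMono a b hab := by
    let _ := partialOrder h
    exact rank_lt_of_le hab.le hab.ne
  edge_vertices e he := by
    have hx : x ≠ 1 := by rintro rfl; have := h.orderOf_left; simp at this; omega
    obtain ⟨g, rfl⟩ := exists_E he
    exact (congrArg _ (vertices_of_edge h g)).trans (Set.encard_pair (V_ne_V_mul h hx g))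
  edge_faces e he := by
    have hy : y ≠ 1 := by rintro rfl; have := h.orderOf_right; simp at this; omega
    obtain ⟨g, rfl⟩ := exists_E he
    exact (congrArg _ (faces_of_edge h g)).trans (Set.encard_pair (F_ne_F_mul h hy g))
  diamond v f hv hf hle := by
    have hx : x ≠ 1 := by rintro rfl; have := h.orderOf_left; simp at this; omega
    have hy : y ≠ 1 := by rintro rfl; have := h.orderOf_right; simp at this; omega
    obtain ⟨g, rfl⟩ := exists_V hv
    obtain ⟨k, rfl⟩ := exists_F hf
    obtain ⟨m, hm, hm'⟩ := V_le_F_iff.mp hle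
    rw [hm, hm']
    refine (congrArg _ (edges_between h m)).trans (Set.encard_pair fun hE => hy ?_)
    have hV : V x y m = V x y (m * y) := by
      simpa using (V_mul_zpow (x := x) (y := y) m 1).symm
    simpa using (eq_of_V_of_E h hx hV hE).symm
  connected := graph_connected h (by omega) (by omega)
  link_connected a ha := by
    rcases ha with ha | ha
    · obtain ⟨g, rfl⟩ := exists_V ha
      exact link_vertex_connected h (by omega) g
    · obtain ⟨g, rfl⟩ := exists_F ha
      exact link_face_connected h (by omega) g

/-! ### Flags, automorphisms and chirality -/

namespace AbstractPolyhedron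

variable (P : AbstractPolyhedron.{u})

/-- A strictly increasing chain of three ranks in `Fin 3` must be `0, 1, 2`, so order isomorphisms
preserve the ranks of flag elements. -/
theorem rank_orderIso_of_flag (Φ : P.Flag) (φ : P.carrier ≃o P.carrier) :
    P.rank (φ Φ.vertex) = 0 ∧ P.rank (φ Φ.edge) = 1 ∧ P.rank (φ Φ.face) = 2 := by
  have h1 : Φ.vertex < Φ.edge := lt_of_le_of_ne Φ.vertex_le_edge fun h => by
    have := Φ.rank_vertex; rw [h, Φ.rank_edge] at this; simp at this
  have h2 : Φ.edge < Φ.face := lt_of_le_of_ne Φ.edge_le_face fun h => by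
    have := Φ.rank_edge; rw [h, Φ.rank_face] at this; simp at this
  have h3 := P.rank_strictMono (φ.strictMono h1)
  have h4 := P.rank_strictMono (φ.strictMono h2)
  omega

variable {P}

/-- The image of a flag under an automorphism. -/
def Flag.map (φ : P.carrier ≃o P.carrier) (Φ : P.Flag) : P.Flag where
  vertex := φ Φ.vertex
  edge := φ Φ.edge
  face := φ Φ.face
  rank_vertex := (P.rank_orderIso_of_flag Φ φ).1
  rank_edge := (P.rank_orderIso_of_flag Φ φ).2.1
  rank_face := (P.rank_orderIso_of_flag Φ φ).2.2
  vertex_le_edge := φ.monotone Φ.vertex_le_edge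
  edge_le_face := φ.monotone Φ.edge_le_face

theorem Flag.equivalent_iff {Φ Ψ : P.Flag} : Φ.Equivalent Ψ ↔ ∃ φ, Φ.map φ = Ψ :=
  ⟨fun ⟨φ, h⟩ => ⟨φ, AbstractPolyhedron.Flag.ext h.1 h.2.1 h.2.2⟩, fun ⟨φ, h⟩ => ⟨φ, by rw [← h]; exact ⟨rfl, rfl, rfl⟩⟩⟩

end AbstractPolyhedron

namespace TightRotary

open CosetElt AbstractPolyhedron

variable {G : Type u} [Group G] {x y : G} {p q : ℕ}

theorem left_ne_one (h : TightRotary x y p q) (hp : 1 < p) : x ≠ 1 := by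
  rintro rfl; have := h.orderOf_left; simp at this; omega

theorem right_ne_one (h : TightRotary x y p q) (hq : 1 < q) : y ≠ 1 := by
  rintro rfl; have := h.orderOf_right; simp at this; omega

/-- The two flags attached to a group element. -/
def flag (h : TightRotary x y p q) (hp : 1 < p) (hq : 1 < q) (g : G) (b : Bool) :
    (h.polyhedron hp hq).Flag where
  vertex := V x y g
  edge := E x y g
  face := if b then F x y g else F x y (g * (x * y))
  rank_vertex := rfl
  rank_edge := rfl
  rank_face := by cases b <;> rfl
  vertex_le_edge := V_le_E g
  edge_le_face := by
    cases b
    · exact (E_le_F_iff h).mpr (Or.inr rfl)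
    · exact E_le_F g

variable (h : TightRotary x y p q) (hp : 1 < p) (hq : 1 < q)

/-- One of the two elements of the edge coset lies in the vertex coset; the Boolean records which of
the two faces of the edge is used. -/
theorem exists_flag (Φ : (h.polyhedron hp hq).Flag) : ∃ g b, Φ = h.flag hp hq g b := by
  obtain ⟨v, e, f, hv, he, hf, hve, hef⟩ := Φ
  obtain ⟨k, rfl⟩ := exists_E he
  obtain ⟨g, rfl⟩ := exists_V hv
  obtain ⟨m, rfl⟩ := exists_F hf
  obtain ⟨n, hn, hn'⟩ : ∃ n, V x y g = V x y n ∧ E x y k = E x y n := by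
    rcases (V_le_E_iff h).mp hve with hk | hk
    · exact ⟨k, hk, rfl⟩
    · exact ⟨_, hk, (E_mul h k).symm⟩
  have hef' : (E x y n).le (F x y m) := hn' ▸ hef
  rcases (E_le_F_iff h).mp hef' with hm | hm
  · exact ⟨n, true, AbstractPolyhedron.Flag.ext hn hn' hm⟩
  · exact ⟨n, false, AbstractPolyhedron.Flag.ext hn hn' hm⟩

theorem flag_face_ne (g : G) (b : Bool) :
    (h.flag hp hq g b).face ≠ (h.flag hp hq g !b).face := by
  have := F_ne_F_mul h (h.right_ne_one hq) g
  cases b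
  · exact this.symm
  · exact this

theorem flag_of_face_ne {g k : G} {b c : Bool}
    (hv : (h.flag hp hq g b).vertex = (h.flag hp hq k c).vertex)
    (he : (h.flag hp hq g b).edge = (h.flag hp hq k c).edge)
    (hf : (h.flag hp hq g b).face ≠ (h.flag hp hq k c).face) : k = g ∧ c = !b := by
  obtain rfl := eq_of_V_of_E h (h.left_ne_one hp) hv he
  refine ⟨rfl, ?_⟩
  cases b <;> cases c <;> simp_all

theorem flag_injective {g k : G} {b c : Bool} (hfl : h.flag hp hq g b = h.flag hp hq k c) :
    g = k ∧ b = c := by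
  obtain rfl := eq_of_V_of_E h (h.left_ne_one hp) (congrArg Flag.vertex hfl)
    (congrArg Flag.edge hfl)
  refine ⟨rfl, ?_⟩
  by_contra hbc
  have : c = !b := by cases b <;> cases c <;> simp_all
  rw [this] at hfl
  exact flag_face_ne h hp hq g b (congrArg Flag.face hfl)

theorem flag_of_vertex_ne {g k : G} {b c : Bool}
    (hv : (h.flag hp hq g b).vertex ≠ (h.flag hp hq k c).vertex)
    (he : (h.flag hp hq g b).edge = (h.flag hp hq k c).edge)
    (hf : (h.flag hp hq g b).face = (h.flag hp hq k c).face) : k = g * (x * y) ∧ c = !b := by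
  rcases (E_eq_E_iff h).mp he with rfl | rfl
  · exact absurd rfl hv
  · refine ⟨rfl, ?_⟩
    by_contra hbc
    have : c = b := by cases b <;> cases c <;> simp_all
    subst this
    cases c
    · exact F_ne_F_mul h (h.right_ne_one hq) _ hf
    · exact F_ne_F_mul h (h.right_ne_one hq) _ hf

/-- Seen from the two faces of an edge, the turn about the vertex goes in opposite directions. This
sign is why an automorphism exchanging the flag classes inverts `y`. -/
theorem flag_of_edge_ne {g k : G} {b c : Bool}
    (hv : (h.flag hp hq g b).vertex = (h.flag hp hq k c).vertex)
    (he : (h.flag hp hq g b).edge ≠ (h.flag hp hq k c).edge)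
    (hf : (h.flag hp hq g b).face = (h.flag hp hq k c).face) :
    k = g * (if b then y else y⁻¹) ∧ c = !b := by
  have hVy : ∀ a : G, V x y (a * y⁻¹) = V x y a := fun a => by
    simpa using V_mul_zpow (x := x) (y := y) a (-1)
  have hv' : V x y g = V x y k := hv
  have he' : g ≠ k := by rintro rfl; exact he rfl
  cases b <;> cases c <;> simp only [flag, Bool.false_eq_true, ↓reduceIte, F_mul h] at hf
  · exact absurd (mul_right_cancel (eq_of_V_of_F h ((hVy g).trans (hv'.trans (hVy k).symm)) hf)) he'
  · exact ⟨(eq_of_V_of_F h ((hVy g).trans hv') hf).symm, rfl⟩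
  · have := eq_of_V_of_F h (hv'.trans (hVy k).symm) hf
    exact ⟨by simp [this], rfl⟩
  · exact absurd (eq_of_V_of_F h hv' hf) he'

theorem flag_ne_of_adjacent {g k : G} {b c : Bool}
    (ha : (h.flag hp hq g b).Adjacent (h.flag hp hq k c)) : c = !b := by
  rcases ha with ⟨hv, he, hf⟩ | ⟨hv, he, hf⟩ | ⟨hv, he, hf⟩
  · exact (flag_of_vertex_ne h hp hq hv he hf).2
  · exact (flag_of_edge_ne h hp hq hv he hf).2
  · exact (flag_of_face_ne h hp hq hv he hf).2

/-- Left multiplication on the coset geometry. -/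
def leftMul (x y k : G) : CosetElt x y → CosetElt x y
  | .vertex v => .vertex (k • v)
  | .edge e => .edge (k • e)
  | .face f => .face (k • f)

theorem leftMul_leftMul (a b : G) (z : CosetElt x y) :
    leftMul x y a (leftMul x y b z) = leftMul x y (a * b) z := by
  cases z <;> simp [leftMul, mul_smul]

theorem leftMul_one (z : CosetElt x y) : leftMul x y 1 z = z := by
  cases z <;> simp [leftMul]

theorem leftMul_inv_leftMul (k : G) (z : CosetElt x y) :
    leftMul x y k⁻¹ (leftMul x y k z) = z := by
  rw [leftMul_leftMul, inv_mul_cancel, leftMul_one]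

theorem leftMul_leftMul_inv (k : G) (z : CosetElt x y) :
    leftMul x y k (leftMul x y k⁻¹ z) = z := by
  rw [leftMul_leftMul, mul_inv_cancel, leftMul_one]

theorem leftMul_le (k : G) {a b : CosetElt x y} (hab : a.le b) :
    (leftMul x y k a).le (leftMul x y k b) := by
  rcases a with a | a | a <;> rcases b with b | b | b <;>
    simp only [CosetElt.le, leftMul] at hab ⊢
  all_goals first
    | rw [hab]
    | (obtain ⟨g, rfl, rfl⟩ := hab; exact ⟨k * g, rfl, rfl⟩)

/-- Left multiplication as an automorphism of the polyhedron. -/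
def leftMulIso (k : G) : (h.polyhedron hp hq).carrier ≃o (h.polyhedron hp hq).carrier where
  toFun := leftMul x y k
  invFun := leftMul x y k⁻¹
  left_inv z := leftMul_inv_leftMul k z
  right_inv z := leftMul_leftMul_inv k z
  map_rel_iff' {a b} := by
    refine ⟨fun hab => ?_, leftMul_le k⟩
    have := leftMul_le k⁻¹ hab
    exact (leftMul_inv_leftMul k a) ▸ (leftMul_inv_leftMul k b) ▸ this

theorem map_leftMulIso (k g : G) (b : Bool) :
    (h.flag hp hq g b).map (h.leftMulIso hp hq k) = h.flag hp hq (k * g) b := by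
  refine AbstractPolyhedron.Flag.ext rfl rfl ?_
  cases b
  · exact congrArg (F x y) (mul_assoc k g (x * y)).symm
  · rfl

theorem equivalent_flag (g k : G) (b : Bool) :
    (h.flag hp hq g b).Equivalent (h.flag hp hq k b) :=
  Flag.equivalent_iff.mpr ⟨h.leftMulIso hp hq (k * g⁻¹), by simp [map_leftMulIso]⟩

section Reversal

variable (φ : (h.polyhedron hp hq).carrier ≃o (h.polyhedron hp hq).carrier)

variable {h hp hq φ}

/-- Automorphisms preserve each kind of adjacency, and the adjacent flag of each kind is unique; the
same argument serves the next two lemmas. -/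
theorem map_flag_not {g k : G} {b c : Bool}
    (hm : (h.flag hp hq g b).map φ = h.flag hp hq k c) :
    (h.flag hp hq g !b).map φ = h.flag hp hq k !c := by
  obtain ⟨m, d, hd⟩ := h.exists_flag hp hq ((h.flag hp hq g !b).map φ)
  have := flag_of_face_ne h hp hq (g := k) (b := c) (k := m) (c := d)
    (by rw [← hm, ← hd]; rfl) (by rw [← hm, ← hd]; rfl)
    (by rw [← hm, ← hd]; exact fun he => flag_face_ne h hp hq g b (φ.injective he))
  rw [hd, this.1, this.2]

theorem map_flag_vertex {g k : G} {b c : Bool}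
    (hm : (h.flag hp hq g b).map φ = h.flag hp hq k c) :
    (h.flag hp hq (g * (x * y)) !b).map φ = h.flag hp hq (k * (x * y)) !c := by
  obtain ⟨m, d, hd⟩ := h.exists_flag hp hq ((h.flag hp hq (g * (x * y)) !b).map φ)
  have hE : (h.flag hp hq (g * (x * y)) !b).edge = (h.flag hp hq g b).edge := E_mul h g
  have hF : (h.flag hp hq (g * (x * y)) !b).face = (h.flag hp hq g b).face := by
    cases b
    · rfl
    · exact congrArg (F x y) (by rw [mul_assoc, h.mul_mul_mul, mul_one])
  have := flag_of_vertex_ne h hp hq (g := k) (b := c) (k := m) (c := d)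
    (by
      rw [← hm, ← hd]
      exact fun he => V_ne_V_mul h (h.left_ne_one hp) g (φ.injective he))
    (by rw [← hm, ← hd]; exact congrArg φ hE.symm)
    (by rw [← hm, ← hd]; exact congrArg φ hF.symm)
  rw [hd, this.1, this.2]

theorem map_flag_edge {g k : G} {b c : Bool}
    (hm : (h.flag hp hq g b).map φ = h.flag hp hq k c) :
    (h.flag hp hq (g * (if b then y else y⁻¹)) !b).map φ =
      h.flag hp hq (k * (if c then y else y⁻¹)) !c := by
  obtain ⟨m, d, hd⟩ := h.exists_flag hp hq
    ((h.flag hp hq (g * (if b then y else y⁻¹)) !b).map φ)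
  have hV : (h.flag hp hq (g * (if b then y else y⁻¹)) !b).vertex = (h.flag hp hq g b).vertex := by
    cases b
    · exact (by simpa using V_mul_zpow (x := x) (y := y) g (-1) : V x y (g * y⁻¹) = V x y g)
    · exact (by simpa using V_mul_zpow (x := x) (y := y) g 1 : V x y (g * y) = V x y g)
  have hF : (h.flag hp hq (g * (if b then y else y⁻¹)) !b).face = (h.flag hp hq g b).face := by
    cases b
    · exact (F_mul h g).symm
    · exact (F_mul h (g * y)).trans (by rw [mul_inv_cancel_right]; rfl)
  have := flag_of_edge_ne h hp hq (g := k) (b := c) (k := m) (c := d)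
    (by rw [← hm, ← hd]; exact congrArg φ hV.symm)
    (by
      rw [← hm, ← hd]
      refine fun he => ?_
      have := eq_of_V_of_E h (h.left_ne_one hp) hV (φ.injective he).symm
      cases b <;> simp [h.right_ne_one hq] at this)
    (by rw [← hm, ← hd]; exact congrArg φ hF.symm)
  rw [hd, this.1, this.2]

/-- Following adjacencies, right multiplication by `x * y` and `y` on the first class corresponds
under `φ` to right multiplication by `x * y` and `y⁻¹` on the second. -/
theorem exists_hom_of_map_flag (hm : (h.flag hp hq 1 true).map φ = h.flag hp hq 1 false) :
    ∃ f : G →* G, f y = y⁻¹ ∧ f (x * y) = x * y := by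
  have ht : ∀ g k, (h.flag hp hq g true).map φ = h.flag hp hq k false →
      (h.flag hp hq (g * (x * y)) true).map φ = h.flag hp hq (k * (x * y)) false := fun g k hgk =>
    map_flag_vertex (map_flag_not hgk)
  have hy : ∀ g k, (h.flag hp hq g true).map φ = h.flag hp hq k false →
      (h.flag hp hq (g * y) true).map φ = h.flag hp hq (k * y⁻¹) false := fun g k hgk =>
    map_flag_not (map_flag_edge hgk)
  have hy' : ∀ g k, (h.flag hp hq g true).map φ = h.flag hp hq k false →
      (h.flag hp hq (g * y⁻¹) true).map φ = h.flag hp hq (k * y) false := fun g k hgk =>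
    map_flag_edge (map_flag_not hgk)
  have hx : ∀ g k, (h.flag hp hq g true).map φ = h.flag hp hq k false →
      (h.flag hp hq (g * x) true).map φ = h.flag hp hq (k * (x * y * y)) false := fun g k hgk => by
    have := hy' _ _ (ht g k hgk)
    rwa [← mul_assoc, mul_inv_cancel_right, mul_assoc k] at this
  -- The starting flag is arbitrary: starting at `1` computes the induced map, starting at `a` shows
  -- that it is multiplicative.
  have key : ∀ i j : ℕ, ∀ g k, (h.flag hp hq g true).map φ = h.flag hp hq k false →
      (h.flag hp hq (g * (x ^ i * y ^ j)) true).map φ =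
        h.flag hp hq (k * ((x * y * y) ^ i * y⁻¹ ^ j)) false := by
    intro i j g k hgk
    induction j with
    | zero =>
      induction i with
      | zero => simpa using hgk
      | succ i ih => simpa [pow_succ, mul_assoc] using hx _ _ ih
    | succ j ih => simpa [pow_succ, mul_assoc] using hy _ _ ih
  have hex : ∀ g, ∃ k, (h.flag hp hq g true).map φ = h.flag hp hq k false := fun g => by
    obtain ⟨i, j, rfl⟩ := h.exists_pow_mul_pow (by omega) (by omega) g
    have := key i j 1 1 hm
    rw [one_mul, one_mul] at this
    exact ⟨_, this⟩
  choose f hf using hex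
  have huniq : ∀ g k, (h.flag hp hq g true).map φ = h.flag hp hq k false → f g = k :=
    fun g k hgk => (flag_injective h hp hq ((hf g).symm.trans hgk)).1
  refine ⟨MonoidHom.mk' f fun a b => ?_, huniq _ _ ?_, huniq _ _ ?_⟩
  · obtain ⟨i, j, rfl⟩ := h.exists_pow_mul_pow (by omega) (by omega) b
    have h1 := huniq _ _ (key i j 1 1 hm)
    rw [one_mul, one_mul] at h1
    rw [h1, huniq _ _ (key i j a _ (hf a))]
  · simpa using hy 1 1 hm
  · simpa using ht 1 1 hm

end Reversal

theorem isChiral_polyhedron (hno : ¬ ∃ f : G →* G, f y = y⁻¹ ∧ f (x * y) = x * y) :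
    (h.polyhedron hp hq).IsChiral := by
  have hne : ∀ g k, ¬ (h.flag hp hq g true).Equivalent (h.flag hp hq k false) := by
    intro g k hgk
    obtain ⟨φ, hφ⟩ := Flag.equivalent_iff.mp hgk
    -- Translations before and after `φ` make both flags sit at the group element `1`.
    refine hno (exists_hom_of_map_flag (h := h) (hp := hp) (hq := hq)
      (φ := ((h.leftMulIso hp hq g).trans φ).trans (h.leftMulIso hp hq k⁻¹)) ?_)
    have h1 := h.map_leftMulIso hp hq g 1 true
    have h2 := h.map_leftMulIso hp hq k⁻¹ k false
    rw [mul_one] at h1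
    rw [inv_mul_cancel, ← hφ, ← h1] at h2
    exact h2
  have hne' : ∀ g k, ¬ (h.flag hp hq g false).Equivalent (h.flag hp hq k true) := by
    intro g k ⟨φ, h1, h2, h3⟩
    exact hne k g ⟨φ.symm, by simp [← h1], by simp [← h2], by simp [← h3]⟩
  refine ⟨fun hr => hne 1 1 (hr _ _), {Φ | ∃ g, Φ = h.flag hp hq g true}, ?_, ?_⟩
  all_goals
    intro Φ Ψ
    obtain ⟨g, b, rfl⟩ := h.exists_flag hp hq Φ
    obtain ⟨k, c, rfl⟩ := h.exists_flag hp hq Ψ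
    have hC : ∀ m d, h.flag hp hq m d ∈ {Φ | ∃ g, Φ = h.flag hp hq g true} ↔ d = true :=
      fun m d => ⟨fun ⟨n, hn⟩ => (flag_injective h hp hq hn).2, fun hd => ⟨m, by rw [hd]⟩⟩
    rw [hC, hC]
  · cases b <;> cases c
    · simp [equivalent_flag]
    · simp [hne']
    · simp [hne]
    · simp [equivalent_flag]
  · intro ha
    rw [flag_ne_of_adjacent h hp hq ha]
    cases b <;> simp

theorem isTightOfType_polyhedron : (h.polyhedron hp hq).IsTightOfType p q := by
  refine ⟨⟨fun f hf => ?_, fun v hv => ?_⟩, ?_⟩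
  · obtain ⟨g, rfl⟩ := exists_F hf
    exact encard_edges_of_face h (h.right_ne_one hq) (by omega) g
  · obtain ⟨g, rfl⟩ := exists_V hv
    exact encard_edges_of_vertex h (h.left_ne_one hp) (by omega) g
  · have hb : Function.Bijective fun z : G × Bool => h.flag hp hq z.1 z.2 :=
      ⟨fun a b hab => Prod.ext (flag_injective h hp hq hab).1 (flag_injective h hp hq hab).2,
        fun Φ => by
          obtain ⟨g, b, rfl⟩ := h.exists_flag hp hq Φ
          exact ⟨(g, b), rfl⟩⟩
    have hf : Finite G := Nat.finite_of_card_ne_zero (by rw [h.card]; positivity)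
    rw [← ENat.card_congr (Equiv.ofBijective _ hb), ENat.card_eq_coe_natCard, Nat.card_prod,
      h.card, Nat.card_eq_fintype_card, Fintype.card_bool]
    push_cast
    ring

end TightRotary

/-! ### Irreversibility and mixing -/

namespace TightRotary

/-- No endomorphism inverts `y` while fixing the half-turn `x * y`. -/
def Irreversible {G : Type*} [Group G] (x y : G) : Prop :=
  ¬ ∃ f : G →* G, f y = y⁻¹ ∧ f (x * y) = x * y

/-- A relation used to distinguish a pair of generators from the pair of their inverses. -/
def CommRel {G : Type*} [Group G] (x y : G) (S M N : ℤ) : Prop :=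
  x ^ (2 * S) * y ^ S = y ^ M * x ^ (2 * N) * (y ^ S * x ^ (2 * S))

section

variable {G : Type*} [Group G] {x y : G} {p q : ℕ}

theorem mul_mul_eq_inv_left (h : TightRotary x y p q) : y * x * y = x⁻¹ :=
  eq_inv_of_mul_eq_one_right (by simpa only [mul_assoc] using h.mul_mul_mul)

theorem mul_mul_eq_inv_right (h : TightRotary x y p q) : x * y * x = y⁻¹ :=
  eq_inv_of_mul_eq_one_left (by simpa only [mul_assoc] using h.mul_mul_mul)

theorem CommRel.map {H : Type*} [Group H] {S M N : ℤ} (hr : CommRel x y S M N) (f : G →* H) :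
    CommRel (f x) (f y) S M N := by
  simpa [CommRel] using congrArg f hr

/-- A reversing endomorphism sends `x` to `x * y * y`; conjugation by `y` then gives `y * x * y =
x⁻¹`. Hence every relation of `(x, y)` would pass to `(x⁻¹, y⁻¹)`. -/
theorem irreversible_of_commRel (h : TightRotary x y p q) {S M N : ℤ} (hr : CommRel x y S M N)
    (hn : ¬ CommRel x⁻¹ y⁻¹ S M N) : Irreversible x y := by
  rintro ⟨f, hy, ht⟩
  have hx : f x = x * y * y := by
    have : f x = f (x * y) * (f y)⁻¹ := by simp
    rw [this, ht, hy, inv_inv]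
  have := hr.map ((MulAut.conj y).toMonoidHom.comp f)
  have h1 : ((MulAut.conj y).toMonoidHom.comp f) x = x⁻¹ := by
    simp [hx, ← h.mul_mul_eq_inv_left, mul_assoc]
  have h2 : ((MulAut.conj y).toMonoidHom.comp f) y = y⁻¹ := by simp [hy]
  rw [h1, h2] at this
  exact hn this

/-- Conjugation by the half-turn converts an endomorphism inverting `x` into one inverting `y`. -/
theorem Irreversible.dual (h : TightRotary x y p q) (hi : Irreversible x y) :
    Irreversible y⁻¹ x⁻¹ := by
  rintro ⟨f, hx, ht⟩
  rw [← mul_inv_rev, h.mul_inv_eq] at ht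
  rw [map_inv, inv_inj] at hx
  refine hi ⟨(MulAut.conj (x * y)).toMonoidHom.comp f, ?_, ?_⟩
  · have hy : f y = x * (x * y) := by
      have : f y = (f x)⁻¹ * f (x * y) := by simp
      rw [this, ht, hx, inv_inv]
    change x * y * f y * (x * y)⁻¹ = y⁻¹
    rw [hy, ← h.mul_mul_eq_inv_right, ← mul_assoc _ x, mul_inv_cancel_right]
  · change x * y * f (x * y) * (x * y)⁻¹ = x * y
    rw [ht, mul_inv_cancel_right]

end

/-- The mix of two tight pairs over a common abelian quotient. -/
theorem exists_mix {G₁ G₂ Q : Type} [Group G₁] [Group G₂] [CommGroup Q] {x₁ y₁ : G₁} {x₂ y₂ : G₂}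
    {p₁ q₁ p₂ q₂ : ℕ} (h₁ : TightRotary x₁ y₁ p₁ q₁) (h₂ : TightRotary x₂ y₂ p₂ q₂)
    (f₁ : G₁ →* Q) (f₂ : G₂ →* Q) (hx : f₁ x₁ = f₂ x₂) (hy : f₁ y₁ = f₂ y₂)
    (hf : Function.Surjective f₁) (hQ : 0 < Nat.card Q)
    (hcard : Nat.card Q * (p₁.lcm p₂ * q₁.lcm q₂) = p₁ * q₁ * (p₂ * q₂)) :
    ∃ (G : Type) (_ : Group G) (x y : G) (π₁ : G →* G₁) (π₂ : G →* G₂),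
      TightRotary x y (p₁.lcm p₂) (q₁.lcm q₂) ∧ π₁ x = x₁ ∧ π₁ y = y₁ ∧ π₂ x = x₂ ∧ π₂ y = y₂ ∧
        ∀ g k, π₁ g = π₁ k → π₂ g = π₂ k → g = k := by
  -- The fibre product is the kernel of the quotient of the two maps, a homomorphism because `Q` is
  -- commutative.
  let κ : G₁ × G₂ →* Q := f₁.comp (MonoidHom.fst G₁ G₂) / f₂.comp (MonoidHom.snd G₁ G₂)
  have hxm : (x₁, x₂) ∈ κ.ker := by simp [κ, MonoidHom.mem_ker, hx]
  have hym : (y₁, y₂) ∈ κ.ker := by simp [κ, MonoidHom.mem_ker, hy]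
  have hκ : Function.Surjective κ := fun z => by
    obtain ⟨g, rfl⟩ := hf z
    exact ⟨(g, 1), by simp [κ]⟩
  refine ⟨κ.ker, inferInstance, ⟨_, hxm⟩, ⟨_, hym⟩, (MonoidHom.fst _ _).comp κ.ker.subtype,
    (MonoidHom.snd _ _).comp κ.ker.subtype, ⟨?_, ?_, ?_, ?_, ?_⟩, rfl, rfl, rfl, rfl,
    fun g k h1 h2 => Subtype.ext (Prod.ext h1 h2)⟩
  · rw [Subgroup.orderOf_mk, Prod.orderOf_mk, h₁.orderOf_left, h₂.orderOf_left]
  · rw [Subgroup.orderOf_mk, Prod.orderOf_mk, h₁.orderOf_right, h₂.orderOf_right]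
  · exact Subtype.ext (Prod.ext h₁.sq_mul h₂.sq_mul)
  · rw [Subgroup.disjoint_def]
    rintro z ⟨i, rfl⟩ ⟨j, hj⟩
    have hj' : ((y₁, y₂) : G₁ × G₂) ^ j = (x₁, x₂) ^ i := by simpa using congrArg Subtype.val hj
    have e1 := h₁.eq_one_of_mem (Subgroup.zpow_mem_zpowers x₁ i) ⟨j, congrArg Prod.fst hj'⟩
    have e2 := h₂.eq_one_of_mem (Subgroup.zpow_mem_zpowers x₂ i) ⟨j, congrArg Prod.snd hj'⟩
    exact Subtype.ext (Prod.ext e1 e2)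
  · have := κ.ker.card_mul_index
    rw [Subgroup.index_ker, MonoidHom.range_eq_top.mpr hκ, Subgroup.card_top, Nat.card_prod,
      h₁.card, h₂.card, ← hcard, mul_comm] at this
    exact Nat.eq_of_mul_eq_mul_left hQ this

theorem dihedral {n : ℕ} :
    TightRotary (DihedralGroup.r 1 : DihedralGroup n) (DihedralGroup.sr 0) n 2 where
  orderOf_left := DihedralGroup.orderOf_r_one
  orderOf_right := DihedralGroup.orderOf_sr 0
  sq_mul := by rw [DihedralGroup.r_mul_sr, pow_two, DihedralGroup.sr_mul_self]
  disjoint := by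
    rw [Subgroup.disjoint_def]
    rintro z ⟨i, rfl⟩ ⟨j, hj⟩
    have h2 : (DihedralGroup.sr 0 : DihedralGroup n) ^ (2 : ℤ) = 1 := by
      rw [zpow_two, DihedralGroup.sr_mul_self]
    rcases Int.even_or_odd' j with ⟨k, rfl | rfl⟩
    · simpa [zpow_mul, h2] using hj.symm
    · simp [zpow_add, zpow_mul, h2] at hj
  card := by rw [DihedralGroup.nat_card, mul_comm]

/-- The abelianization map of a dihedral group of even degree. -/
def dihedralHom {n : ℕ} (hn : 2 ∣ n) :
    DihedralGroup n →* Multiplicative (ZMod 2) × Multiplicative (ZMod 2) where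
  toFun
    | .r i => (.ofAdd (ZMod.castHom hn (ZMod 2) i), 1)
    | .sr i => (.ofAdd (ZMod.castHom hn (ZMod 2) i), .ofAdd 1)
  map_one' := by
    change (_, _) = _
    simp
  map_mul' a b := by
    have key : ∀ u v : ZMod 2, v - u = u + v := by decide
    have h11 : (1 : ZMod 2) + 1 = 0 := by decide
    generalize ZMod.castHom hn (ZMod 2) = c
    rcases a with i | i <;> rcases b with j | j <;>
      simp [DihedralGroup.r_mul_r, DihedralGroup.r_mul_sr, DihedralGroup.sr_mul_r,
        DihedralGroup.sr_mul_sr, ← ofAdd_add, key, h11]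

end TightRotary

namespace TightRotary

/-- The Klein four-group as a target of abelianization maps. -/
abbrev KleinFour : Type := Multiplicative (ZMod 2) × Multiplicative (ZMod 2)

theorem surjective_of_generators {G : Type*} [Group G] {x y : G} (f : G →* KleinFour)
    (hx : f x = (.ofAdd 1, 1)) (hy : f y = (1, .ofAdd 1)) : Function.Surjective f := by
  have key : ∀ z : KleinFour, z = 1 ∨ z = (.ofAdd 1, 1) ∨ z = (1, .ofAdd 1) ∨
      z = (.ofAdd 1, 1) * (1, .ofAdd 1) := by decide
  intro z
  rcases key z with rfl | rfl | rfl | rfl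
  · exact ⟨1, map_one f⟩
  · exact ⟨x, hx⟩
  · exact ⟨y, hy⟩
  · exact ⟨x * y, by rw [map_mul, hx, hy]⟩

theorem card_kleinFour : Nat.card KleinFour = 4 := by
  rw [Nat.card_prod]
  simp

theorem dihedralHom_r {n : ℕ} (hn : 2 ∣ n) (i : ZMod n) :
    dihedralHom hn (.r i) = (.ofAdd (ZMod.castHom hn (ZMod 2) i), 1) := rfl

theorem dihedralHom_sr {n : ℕ} (hn : 2 ∣ n) (i : ZMod n) :
    dihedralHom hn (.sr i) = (.ofAdd (ZMod.castHom hn (ZMod 2) i), .ofAdd 1) := rfl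

/-- Tight rotary pairs of every type with both entries even. -/
theorem exists_of_even {p q : ℕ} (hp : Even p) (hq : Even q) :
    ∃ (G : Type) (_ : Group G) (x y : G) (f : G →* KleinFour),
      TightRotary x y p q ∧ f x = (.ofAdd 1, 1) ∧ f y = (1, .ofAdd 1) := by
  have hp2 := hp.two_dvd
  have hq2 := hq.two_dvd
  have hx : dihedralHom hp2 (DihedralGroup.r 1) = (.ofAdd 1, 1) := by
    rw [dihedralHom_r, map_one]
  have hy : dihedralHom hp2 (DihedralGroup.sr 0) = (1, .ofAdd 1) := by
    rw [dihedralHom_sr, map_zero, ofAdd_zero]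
  have hlp : p.lcm 2 = p := Nat.lcm_eq_left hp2
  have hlq : Nat.lcm 2 q = q := Nat.lcm_eq_right hq2
  -- Types `{p, 2}` and `{2, q}` are mixed over the Klein four-group; the orders agree since `4pq =
  -- 2p · 2q`.
  obtain ⟨G, i, x, y, π, -, h, h1, h2, -⟩ := exists_mix (dihedral (n := p)) (dihedral (n := q)).dual
    (dihedralHom hp2) ((MulEquiv.prodComm.toMonoidHom).comp (dihedralHom hq2))
    (by rw [hx, MonoidHom.comp_apply, map_inv, dihedralHom_sr, map_zero]; decide)
    (by rw [hy, MonoidHom.comp_apply, map_inv, dihedralHom_r,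
      map_one (ZMod.castHom hq2 (ZMod 2))]; decide) (surjective_of_generators _ hx hy)
    (by rw [card_kleinFour]; norm_num) (by rw [card_kleinFour, hlp, hlq]; ring)
  rw [hlp, hlq] at h
  exact ⟨G, i, x, y, (dihedralHom hp2).comp π, h, by simp [h1, hx], by simp [h2, hy]⟩

end TightRotary

/-! ### The class-two group and its extension by an involution -/

/-- Parameters of a class-two extension, carrying an involution that swaps its two generators. -/
structure TwistData (A B C : Type*) [CommRing A] [CommRing B] [CommRing C] where
  σ : A →+* B
  ρ : B →+* C
  κ : C →+ A
  l : C →+ B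
  β : A → C
  -- These two conditions make the commutators `(κ z, l z)` central.
  ρ_σ_κ : ∀ z, ρ (σ (κ z)) = 0
  ρ_l : ∀ z, ρ (l z) = 0
  -- The involution has to invert commutators.
  σ_κ : ∀ z, σ (κ z) = -(l z + l z)
  -- `β u` plays the role of `u(u - 1)/2`, the exponent that appears when the power `(a⁻¹b)^u` is
  -- collected.
  β_add : ∀ u v, β (u + v) = β u + β v + ρ (σ u) * ρ (σ v)
  β_κ : ∀ z, β (κ z) = 0
  β_one : β 1 = 0
  β_two : ∀ u, β u + β u = ρ (σ u) * ρ (σ u) - ρ (σ u)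

namespace TwistData

variable {A B C : Type*} [CommRing A] [CommRing B] [CommRing C] (D : TwistData A B C)

theorem β_neg (u : A) : D.β (-u) = D.β u + D.ρ (D.σ u) := by
  have h1 := D.β_add u (-u)
  have h0 : D.β 0 = 0 := by simpa using D.β_κ 0
  have h2 := D.β_two u
  rw [add_neg_cancel, h0, map_neg, map_neg] at h1
  linear_combination -h1 - h2

theorem β_add_κ (u : A) (z : C) : D.β (u + D.κ z) = D.β u := by
  rw [D.β_add, D.β_κ, D.ρ_σ_κ, mul_zero, add_zero, add_zero]

/-- The class-two group of the parameters. -/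
@[ext]
structure Base (D : TwistData A B C) where
  fst : A
  snd : B

namespace Base

variable {D}

/-- The pair `(u, v)` stands for `a^u b^v`; moving a power of `b` past a power of `a` costs a
central commutator bilinear in the exponents. -/
instance : Mul D.Base where
  mul g k := ⟨g.fst + k.fst + D.κ (D.ρ g.snd * D.ρ (D.σ k.fst)),
    g.snd + k.snd + D.l (D.ρ g.snd * D.ρ (D.σ k.fst))⟩

instance : One D.Base := ⟨⟨0, 0⟩⟩

instance : Inv D.Base where
  inv g := ⟨-g.fst + D.κ (D.ρ g.snd * D.ρ (D.σ g.fst)),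
    -g.snd + D.l (D.ρ g.snd * D.ρ (D.σ g.fst))⟩

@[simp] theorem fst_mul (g k : D.Base) :
    (g * k).fst = g.fst + k.fst + D.κ (D.ρ g.snd * D.ρ (D.σ k.fst)) := rfl
@[simp] theorem snd_mul (g k : D.Base) :
    (g * k).snd = g.snd + k.snd + D.l (D.ρ g.snd * D.ρ (D.σ k.fst)) := rfl
theorem mk_mul_mk (a c : A) (b d : B) :
    (⟨a, b⟩ : D.Base) * ⟨c, d⟩ =
      ⟨a + c + D.κ (D.ρ b * D.ρ (D.σ c)), b + d + D.l (D.ρ b * D.ρ (D.σ c))⟩ := rfl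
@[simp] theorem fst_one : (1 : D.Base).fst = 0 := rfl
@[simp] theorem snd_one : (1 : D.Base).snd = 0 := rfl
@[simp] theorem fst_inv (g : D.Base) :
    g⁻¹.fst = -g.fst + D.κ (D.ρ g.snd * D.ρ (D.σ g.fst)) := rfl
@[simp] theorem snd_inv (g : D.Base) :
    g⁻¹.snd = -g.snd + D.l (D.ρ g.snd * D.ρ (D.σ g.fst)) := rfl

instance : Group D.Base := Group.ofLeftAxioms
  (fun a b c => by
    ext
    · simp only [fst_mul, snd_mul, map_add, D.ρ_σ_κ, D.ρ_l, add_zero, add_mul, mul_add]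
      ring
    · simp only [fst_mul, snd_mul, map_add, D.ρ_σ_κ, D.ρ_l, add_zero, add_mul, mul_add]
      ring)
  (fun a => by ext <;> simp)
  (fun a => by
    ext
    · simp [D.ρ_l]
    · simp [D.ρ_l])

/-- The involution of the class-two group. -/
def twist (g : D.Base) : D.Base :=
  -- This extends `a ↦ a⁻¹b` and `b ↦ a⁻¹ba`, written in the normal form `a^u b^v`.
  ⟨-g.fst + D.κ (D.ρ g.snd - D.β g.fst), D.σ g.fst + g.snd + D.l (D.ρ g.snd - D.β g.fst)⟩

theorem twist_mul (g k : D.Base) : twist (g * k) = twist g * twist k := by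
  ext
  · simp only [twist, fst_mul, snd_mul, map_add, map_sub, map_neg, D.ρ_σ_κ, D.ρ_l, D.β_add, D.β_κ,
      add_zero, mul_zero, add_mul, mul_neg, sub_self]
    ring
  · simp only [twist, fst_mul, snd_mul, map_add, map_sub, map_neg, D.ρ_l, D.β_add, D.β_κ,
      map_zero, add_zero, mul_zero, add_mul, mul_neg, D.σ_κ, sub_self]
    ring

theorem twist_twist (g : D.Base) : twist (twist g) = g := by
  simp only [twist, D.β_add_κ, D.β_neg]
  ext
  · simp only [map_add, map_sub, D.ρ_l]
    ring
  · simp only [map_add, map_sub, map_neg, D.ρ_l, D.σ_κ]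
    ring

/-- The involution as an automorphism. -/
def twistAut (D : TwistData A B C) : MulAut D.Base where
  toFun := twist
  invFun := twist
  left_inv := twist_twist
  right_inv := twist_twist
  map_mul' := twist_mul

theorem natCard : Nat.card D.Base = Nat.card A * Nat.card B := by
  rw [← Nat.card_prod]
  exact Nat.card_congr ⟨fun g => (g.fst, g.snd), fun z => ⟨z.1, z.2⟩, fun _ => rfl, fun _ => rfl⟩

theorem fst_pow (n : ℕ) : (⟨1, 0⟩ : D.Base) ^ n = ⟨n, 0⟩ := by
  induction n with
  | zero => ext <;> simp
  | succ n ih => rw [pow_succ, ih]; ext <;> simp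

theorem snd_pow (n : ℕ) : (⟨0, 1⟩ : D.Base) ^ n = ⟨0, n⟩ := by
  induction n with
  | zero => ext <;> simp
  | succ n ih => rw [pow_succ, ih]; ext <;> simp

theorem fst_zpow (n : ℤ) : (⟨1, 0⟩ : D.Base) ^ n = ⟨n, 0⟩ := by
  rcases Int.eq_nat_or_neg n with ⟨n, rfl | rfl⟩
  · rw [zpow_natCast, fst_pow, Int.cast_natCast]
  · rw [zpow_neg, zpow_natCast, fst_pow]; ext <;> simp

theorem snd_zpow (n : ℤ) : (⟨0, 1⟩ : D.Base) ^ n = ⟨0, n⟩ := by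
  rcases Int.eq_nat_or_neg n with ⟨n, rfl | rfl⟩
  · rw [zpow_natCast, snd_pow, Int.cast_natCast]
  · rw [zpow_neg, zpow_natCast, snd_pow]; ext <;> simp

theorem orderOf_fst : orderOf (⟨1, 0⟩ : D.Base) = addOrderOf (1 : A) := by
  refine Nat.dvd_antisymm (orderOf_dvd_of_pow_eq_one ?_) (addOrderOf_dvd_of_nsmul_eq_zero ?_)
  · have h := addOrderOf_nsmul_eq_zero (1 : A)
    rw [nsmul_one] at h
    rw [fst_pow, h]; rfl
  · have h := congrArg Base.fst (pow_orderOf_eq_one (⟨1, 0⟩ : D.Base))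
    rw [fst_pow] at h
    rw [nsmul_one]; exact h

theorem orderOf_snd : orderOf (⟨0, 1⟩ : D.Base) = addOrderOf (1 : B) := by
  refine Nat.dvd_antisymm (orderOf_dvd_of_pow_eq_one ?_) (addOrderOf_dvd_of_nsmul_eq_zero ?_)
  · have h := addOrderOf_nsmul_eq_zero (1 : B)
    rw [nsmul_one] at h
    rw [snd_pow, h]; rfl
  · have h := congrArg Base.snd (pow_orderOf_eq_one (⟨0, 1⟩ : D.Base))
    rw [snd_pow] at h
    rw [nsmul_one]; exact h

theorem mul_twist : (⟨1, 0⟩ : D.Base) * twist ⟨1, 0⟩ = ⟨0, 1⟩ := by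
  ext <;> simp [twist, D.β_one]

end Base

/-- The action of the group of order two through the involution. -/
def action (D : TwistData A B C) : Multiplicative (ZMod 2) →* MulAut D.Base where
  toFun e := if e = 1 then 1 else Base.twistAut D
  map_one' := if_pos rfl
  map_mul' a b := by
    have h : Base.twistAut D * Base.twistAut D = 1 := MulEquiv.ext Base.twist_twist
    have key : ∀ z : Multiplicative (ZMod 2), z = 1 ∨ z = .ofAdd 1 := by decide
    have h1 : (.ofAdd 1 : Multiplicative (ZMod 2)) ≠ 1 := by decide
    have h2 : (.ofAdd 1 * .ofAdd 1 : Multiplicative (ZMod 2)) = 1 := by decide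
    rcases key a with rfl | rfl <;> rcases key b with rfl | rfl
    · simp
    · simp
    · simp
    · rw [h2, if_pos rfl, if_neg h1, h]

/-- The extension of the class-two group by its involution. -/
abbrev Ext (D : TwistData A B C) : Type _ := D.Base ⋊[D.action] Multiplicative (ZMod 2)

/-- The generator of the second factor. -/
def halfTurn (D : TwistData A B C) : D.Ext := SemidirectProduct.inr (.ofAdd 1)

/-- The rotation about a vertex. -/
def vertexRot (D : TwistData A B C) : D.Ext := SemidirectProduct.inl ⟨1, 0⟩

/-- The rotation about a face. -/
def faceRot (D : TwistData A B C) : D.Ext := D.halfTurn * D.vertexRot⁻¹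

theorem faceRot_mul_vertexRot : D.faceRot * D.vertexRot = D.halfTurn := by
  simp [faceRot]

theorem halfTurn_sq : D.halfTurn ^ 2 = 1 := by
  rw [halfTurn, ← map_pow, show (.ofAdd 1 : Multiplicative (ZMod 2)) ^ 2 = 1 by decide, map_one]

theorem halfTurn_conj (g : D.Base) :
    D.halfTurn * SemidirectProduct.inl g = SemidirectProduct.inl g.twist * D.halfTurn := by
  have h1 : (.ofAdd 1 : Multiplicative (ZMod 2)) ≠ 1 := by decide
  have h := SemidirectProduct.inl_aut (φ := D.action) (.ofAdd 1) g
  have h2 : D.action (.ofAdd 1) g = g.twist := by simp only [action]; rfl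
  rw [h2] at h
  rw [h, halfTurn, map_inv, inv_mul_cancel_right]

/-- With `t` the half-turn, `t a⁻¹ t a⁻¹` is the inverse of `a · a^t = b`. -/
theorem faceRot_sq : D.faceRot ^ 2 = SemidirectProduct.inl (⟨0, 1⟩ : D.Base)⁻¹ := by
  have ht : D.halfTurn⁻¹ = D.halfTurn :=
    inv_eq_of_mul_eq_one_left (by rw [← pow_two, halfTurn_sq])
  rw [← inv_inj, ← map_inv, inv_inv, ← Base.mul_twist, map_mul, ← inv_pow, pow_two, faceRot,
    mul_inv_rev, inv_inv, ht, mul_assoc, ← mul_assoc D.halfTurn, vertexRot, halfTurn_conj,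
    mul_assoc _ D.halfTurn, ← pow_two, halfTurn_sq, mul_one]

theorem rightHom_faceRot : SemidirectProduct.rightHom D.faceRot = .ofAdd 1 := by
  simp [faceRot, halfTurn, vertexRot]

theorem rightHom_vertexRot : SemidirectProduct.rightHom D.vertexRot = 1 := by
  simp [vertexRot]

theorem faceRot_zpow (S : ℤ) :
    D.faceRot ^ (2 * S) = SemidirectProduct.inl (⟨0, ((-S : ℤ) : B)⟩ : D.Base) := by
  rw [zpow_mul, show D.faceRot ^ (2 : ℤ) = D.faceRot ^ 2 from zpow_natCast _ 2, faceRot_sq,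
    ← map_zpow, inv_zpow, ← zpow_neg, Base.snd_zpow]

theorem vertexRot_zpow (S : ℤ) :
    D.vertexRot ^ S = SemidirectProduct.inl (⟨(S : A), 0⟩ : D.Base) := by
  rw [vertexRot, ← map_zpow, Base.fst_zpow]

/-- The image in the group of order two shows that the order is even, hence twice that of the
square. -/
theorem orderOf_faceRot :
    orderOf D.faceRot = 2 * addOrderOf (1 : B) := by
  have h2 : 2 ∣ orderOf D.faceRot := by
    have := orderOf_map_dvd (SemidirectProduct.rightHom (φ := D.action)) D.faceRot
    rwa [rightHom_faceRot, orderOf_ofAdd_eq_addOrderOf, ZMod.addOrderOf_one] at this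
  have h := orderOf_pow_of_dvd (x := D.faceRot) two_ne_zero h2
  rw [faceRot_sq, map_inv, orderOf_inv, orderOf_injective _ SemidirectProduct.inl_injective,
    Base.orderOf_snd] at h
  omega

theorem tightRotary (hcA : Nat.card A = addOrderOf (1 : A))
    (hcB : Nat.card B = addOrderOf (1 : B)) :
    TightRotary D.faceRot D.vertexRot (2 * addOrderOf (1 : B)) (addOrderOf (1 : A)) where
  orderOf_left := D.orderOf_faceRot
  orderOf_right := by
    rw [vertexRot, orderOf_injective _ SemidirectProduct.inl_injective, Base.orderOf_fst]
  sq_mul := by rw [faceRot_mul_vertexRot, halfTurn_sq]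
  disjoint := by
    rw [Subgroup.disjoint_def]
    rintro z ⟨i, rfl⟩ ⟨j, hj⟩
    change D.faceRot ^ i = 1
    replace hj : D.vertexRot ^ j = D.faceRot ^ i := hj
    -- Even powers of `x` are powers of `b`, so coordinates can be compared; odd powers leave the
    -- base group.
    rcases Int.even_or_odd' i with ⟨k, rfl | rfl⟩
    · rw [faceRot_zpow, vertexRot_zpow] at hj
      rw [faceRot_zpow]
      have := congrArg Base.fst (SemidirectProduct.inl_injective hj)
      have h2 := congrArg Base.snd (SemidirectProduct.inl_injective hj)
      simp only at this h2
      rw [← h2]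
      exact map_one _
    · have := congrArg (SemidirectProduct.rightHom (φ := D.action)) hj
      rw [zpow_add, zpow_mul, map_mul, map_zpow, map_zpow, map_zpow, map_zpow, rightHom_faceRot,
        rightHom_vertexRot, one_zpow, zpow_one,
        show (.ofAdd 1 : Multiplicative (ZMod 2)) ^ (2 : ℤ) = 1 by decide, one_zpow, one_mul] at this
      exact absurd this (by decide)
  card := by
    rw [SemidirectProduct.card, Base.natCard, hcA, hcB]
    simp
    ring

/-- Put both sides in normal form: exchanging `b^(-S)` and `a^S` produces the commutator to the
power `-S²`, and `hN` makes the other exchange free. -/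
theorem zpow_relation_iff {K L : ℤ} (hK : D.κ 1 = K) (hL : D.l 1 = L) (S M N : ℤ)
    (hN : D.ρ (N : B) = 0) :
    D.faceRot ^ (2 * S) * D.vertexRot ^ S =
        D.vertexRot ^ M * D.faceRot ^ (2 * N) * (D.vertexRot ^ S * D.faceRot ^ (2 * S)) ↔
      ((-(S * S * K) : ℤ) : A) = M ∧ ((S * S * L : ℤ) : B) = N := by
  have hκ : D.κ ((S : C) * S) = (S * S * K : ℤ) := by
    have : (S : C) * S = (S * S : ℤ) • 1 := by simp
    rw [this, map_zsmul, hK]; simp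
  have hl : D.l ((S : C) * S) = (S * S * L : ℤ) := by
    have : (S : C) * S = (S * S : ℤ) • 1 := by simp
    rw [this, map_zsmul, hL]; simp
  have hN' : (N : C) = 0 := by simpa using hN
  simp only [faceRot_zpow, vertexRot_zpow, ← map_mul, SemidirectProduct.inl_inj, Base.mk_mul_mk,
    Base.mk.injEq, map_intCast, map_zero, mul_zero, zero_mul, add_zero, zero_add,
    Int.cast_neg, neg_mul, map_neg, hκ, hl, hN', neg_zero]
  refine and_congr ⟨fun h => ?_, fun h => ?_⟩ ⟨fun h => ?_, fun h => ?_⟩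
  · linear_combination h
  · linear_combination h
  · linear_combination -h
  · linear_combination -h

theorem commRel {K L : ℤ} (hK : D.κ 1 = K) (hL : D.l 1 = L) (S : ℤ) :
    TightRotary.CommRel D.faceRot D.vertexRot S (-(S * S * K)) (S * S * L) := by
  refine (D.zpow_relation_iff hK hL S _ _ ?_).mpr ⟨rfl, rfl⟩
  rw [Int.cast_mul, ← hL, map_mul, D.ρ_l, mul_zero]

/-- Inverting both generators changes the signs of `S`, `M`, `N` but not of `S²`; comparing first
coordinates would give `2S²K = 0`. -/
theorem not_commRel_inv {K L : ℤ} (hK : D.κ 1 = K) (hL : D.l 1 = L) (S : ℤ)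
    (hS : ((2 * (S * S * K) : ℤ) : A) ≠ 0) :
    ¬ TightRotary.CommRel D.faceRot⁻¹ D.vertexRot⁻¹ S (-(S * S * K)) (S * S * L) := by
  intro h
  simp only [TightRotary.CommRel, inv_zpow', ← mul_neg] at h
  have := ((D.zpow_relation_iff hK hL (-S) _ _ ?_).mp h).1
  · apply hS
    push_cast at this ⊢
    linear_combination -this
  · rw [mul_neg, ← neg_mul, Int.cast_mul, ← hL, map_mul, D.ρ_l, mul_zero]

end TwistData

/-! ### Parameters over residue rings -/

namespace TwistData

/-- The additive map `ZMod n → ZMod q` sending `1` to `K`. -/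
def scale (n q : ℕ) (K : ℤ) (hK : (q : ℤ) ∣ n * K) : ZMod n →+ ZMod q :=
  ZMod.lift n ⟨zmultiplesHom (ZMod q) (K : ZMod q), by
    have := (ZMod.intCast_zmod_eq_zero_iff_dvd (n * K) q).mpr hK
    simpa using this⟩

theorem scale_intCast {n q : ℕ} {K : ℤ} (hK : (q : ℤ) ∣ n * K) (a : ℤ) :
    scale n q K hK a = (a * K : ℤ) := by
  rw [scale, ZMod.lift_coe]
  simp

theorem castHom_scale {d n q : ℕ} {K : ℤ} (hK : (q : ℤ) ∣ n * K) (hd : d ∣ q) (hdK : (d : ℤ) ∣ K)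
    (z : ZMod n) : ZMod.castHom hd (ZMod d) (scale n q K hK z) = 0 := by
  obtain ⟨a, rfl⟩ := ZMod.intCast_surjective z
  rw [scale_intCast, map_intCast]
  exact (ZMod.intCast_zmod_eq_zero_iff_dvd _ _).mpr (hdK.mul_left a)

/-- Parameters over residue rings. -/
def ofZMod (n q r : ℕ) (K L : ℤ) (hrq : r ∣ q) (hnr : n ∣ r) (hK : (q : ℤ) ∣ n * K)
    (hL : (r : ℤ) ∣ n * L) (hnK : (n : ℤ) ∣ K) (hnL : (n : ℤ) ∣ L) (hKL : (r : ℤ) ∣ K + 2 * L)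
    (β : ZMod q → ZMod n)
    (β_add : ∀ u v, β (u + v) = β u + β v +
      ZMod.castHom (hnr.trans hrq) (ZMod n) u * ZMod.castHom (hnr.trans hrq) (ZMod n) v)
    (β_scale : ∀ z, β (scale n q K hK z) = 0) (β_one : β 1 = 0)
    (β_two : ∀ u, β u + β u =
      ZMod.castHom (hnr.trans hrq) (ZMod n) u * ZMod.castHom (hnr.trans hrq) (ZMod n) u -
        ZMod.castHom (hnr.trans hrq) (ZMod n) u) :
    TwistData (ZMod q) (ZMod r) (ZMod n) :=
  have hcomp : ∀ u, ZMod.castHom hnr (ZMod n) (ZMod.castHom hrq (ZMod r) u) =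
      ZMod.castHom (hnr.trans hrq) (ZMod n) u := fun u =>
    RingHom.congr_fun (RingHom.ext_zmod ((ZMod.castHom hnr (ZMod n)).comp
      (ZMod.castHom hrq (ZMod r))) (ZMod.castHom (hnr.trans hrq) (ZMod n))) u
  { σ := ZMod.castHom hrq (ZMod r)
    ρ := ZMod.castHom hnr (ZMod n)
    κ := scale n q K hK
    l := scale n r L hL
    β := β
    ρ_σ_κ := fun z => by rw [hcomp, castHom_scale hK _ hnK]
    ρ_l := castHom_scale hL hnr hnL
    σ_κ := fun z => by
      obtain ⟨a, rfl⟩ := ZMod.intCast_surjective z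
      have h := (ZMod.intCast_zmod_eq_zero_iff_dvd _ _).mpr (hKL.mul_left a)
      rw [scale_intCast, scale_intCast, map_intCast]
      push_cast at h ⊢
      linear_combination h
    β_add := fun u v => by rw [hcomp, hcomp, β_add]
    β_κ := β_scale
    β_one := β_one
    β_two := fun u => by rw [hcomp, β_two] }

theorem ofZMod_κ_one {n q r : ℕ} {K L : ℤ} (hrq hnr hK hL hnK hnL hKL β β_add β_scale β_one β_two) :
    (ofZMod n q r K L hrq hnr hK hL hnK hnL hKL β β_add β_scale β_one β_two).κ 1 = K := by
  have h := scale_intCast hK 1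
  rw [Int.cast_one, one_mul] at h
  exact h

theorem ofZMod_l_one {n q r : ℕ} {K L : ℤ} (hrq hnr hK hL hnK hnL hKL β β_add β_scale β_one β_two) :
    (ofZMod n q r K L hrq hnr hK hL hnK hnL hKL β β_add β_scale β_one β_two).l 1 = L := by
  have h := scale_intCast hL 1
  rw [Int.cast_one, one_mul] at h
  exact h

theorem tightRotary_zmod {n q r : ℕ} (D : TwistData (ZMod q) (ZMod r) (ZMod n)) :
    TightRotary D.faceRot D.vertexRot (2 * r) q := by
  simpa using D.tightRotary (by simp) (by simp)

/-- The parameters attached to an odd modulus. -/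
theorem exists_odd (m : ℕ) (hm : Odd m) {q r : ℕ} (hmq : m ^ 2 ∣ q) (hmr : m ∣ r) (hrq : r ∣ q) :
    ∃ (D : TwistData (ZMod q) (ZMod r) (ZMod m)) (L : ℤ), D.κ 1 = ((q / m : ℕ) : ℤ) ∧
      D.l 1 = L := by
  obtain ⟨h, rfl⟩ := hm
  have hm0 : 0 < 2 * h + 1 := by omega
  set m := 2 * h + 1 with hm
  obtain ⟨k, rfl⟩ := hmq
  have hK : m ^ 2 * k / m = m * k := by
    rw [pow_two, mul_assoc, Nat.mul_div_cancel_left _ hm0]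
  -- `h + 1` is the inverse of `2` modulo `m`.
  have hu : ((h + 1 : ℕ) : ZMod m) + ((h + 1 : ℕ) : ZMod m) = 1 := by
    have : ((m : ℕ) : ZMod m) = 0 := ZMod.natCast_self m
    rw [hm] at this
    push_cast at this ⊢
    linear_combination this
  rw [hK]
  have hKd : ((m ^ 2 * k : ℕ) : ℤ) ∣ m * ((m * k : ℕ) : ℤ) := by
    refine Dvd.intro 1 ?_
    push_cast
    ring
  have hrz : (r : ℤ) ∣ ((m ^ 2 * k : ℕ) : ℤ) := Int.natCast_dvd_natCast.mpr hrq
  -- With `K = q/m` and `L = -K(m + 1)/2`, the sum `K + 2L` equals `-mK = -q`, a multiple of `r`.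
  -- The map `β` is `u(u - 1)/2`.
  refine ⟨ofZMod m (m ^ 2 * k) r ((m * k : ℕ) : ℤ) (-((m * k : ℕ) * ((h + 1 : ℕ) : ℤ))) hrq hmr hKd
    ?_ ?_ ?_ ?_ (fun u => (ZMod.castHom (hmr.trans hrq) (ZMod m) u *
      ZMod.castHom (hmr.trans hrq) (ZMod m) u - ZMod.castHom (hmr.trans hrq) (ZMod m) u) *
        ((h + 1 : ℕ) : ZMod m)) ?_ ?_ ?_ ?_, -((m * k : ℕ) * ((h + 1 : ℕ) : ℤ)),
      ofZMod_κ_one .., ofZMod_l_one ..⟩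
  · refine hrz.trans (Dvd.intro (-(h + 1 : ℤ)) ?_)
    push_cast
    ring
  · exact Dvd.intro (k : ℤ) (by push_cast; ring)
  · exact Dvd.intro (-(k * (h + 1)) : ℤ) (by push_cast; ring)
  · refine hrz.trans (Dvd.intro (-1) ?_)
    rw [hm]
    push_cast
    ring
  · intro u v
    simp only [map_add]
    linear_combination (ZMod.castHom (hmr.trans hrq) (ZMod m) u *
      ZMod.castHom (hmr.trans hrq) (ZMod m) v) * hu
  · intro z
    rw [castHom_scale hKd _ (Dvd.intro (k : ℤ) (by push_cast; ring))]
    simp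
  · rw [map_one]
    simp
  · intro u
    linear_combination (ZMod.castHom (hmr.trans hrq) (ZMod m) u *
      ZMod.castHom (hmr.trans hrq) (ZMod m) u - ZMod.castHom (hmr.trans hrq) (ZMod m) u) * hu

/-- The residue of `v * (v - 1) / 2` modulo `4`. -/
def choose8 (v : ZMod 8) : ZMod 4 := ((v.val * (v.val - 1) / 2 : ℕ) : ZMod 4)

theorem choose8_add : ∀ u v, choose8 (u + v) = choose8 u + choose8 v +
    ZMod.castHom (by norm_num : 4 ∣ 8) (ZMod 4) u *
      ZMod.castHom (by norm_num : 4 ∣ 8) (ZMod 4) v := by decide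

theorem choose8_two : ∀ u, choose8 u + choose8 u =
    ZMod.castHom (by norm_num : 4 ∣ 8) (ZMod 4) u *
      ZMod.castHom (by norm_num : 4 ∣ 8) (ZMod 4) u -
        ZMod.castHom (by norm_num : 4 ∣ 8) (ZMod 4) u := by decide

/-- The parameters attached to the modulus four. -/
theorem exists_four {q r : ℕ} (hq : 32 ∣ q) (hr : 4 ∣ r) (hrq : 2 * r ∣ q) :
    ∃ (D : TwistData (ZMod q) (ZMod r) (ZMod 4)) (L : ℤ), D.κ 1 = ((q / 4 : ℕ) : ℤ) ∧
      D.l 1 = L := by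
  obtain ⟨k, rfl⟩ := hq
  have hrq' : r ∣ 32 * k := (Dvd.intro_left 2 rfl).trans hrq
  have hr16 : r ∣ 16 * k := by
    refine Nat.dvd_of_mul_dvd_mul_left two_pos (hrq.trans (Dvd.intro 1 ?_))
    ring
  have h8 : 8 ∣ 32 * k := Dvd.intro (4 * k) (by ring)
  have hc : ∀ u, ZMod.castHom (hr.trans hrq') (ZMod 4) u =
      ZMod.castHom (by norm_num : 4 ∣ 8) (ZMod 4) (ZMod.castHom h8 (ZMod 8) u) := fun u =>
    RingHom.congr_fun (RingHom.ext_zmod (ZMod.castHom (hr.trans hrq') (ZMod 4))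
      ((ZMod.castHom (by norm_num : 4 ∣ 8) (ZMod 4)).comp (ZMod.castHom h8 (ZMod 8)))) u
  rw [show 32 * k / 4 = 8 * k by omega]
  have hKd : ((32 * k : ℕ) : ℤ) ∣ (4 : ℕ) * ((8 * k : ℕ) : ℤ) := by
    refine Dvd.intro 1 ?_
    push_cast
    ring
  -- Here `K = q/4` and `L = -K/2`, so `K + 2L = 0`. The residue of `u(u - 1)/2` modulo `4` depends
  -- on `u` modulo `8`, and `8 ∣ K` makes it vanish on multiples of `K`.
  refine ⟨ofZMod 4 (32 * k) r ((8 * k : ℕ) : ℤ) (-(4 * k)) hrq' hr hKd ?_ ?_ ?_ ?_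
    (fun u => choose8 (ZMod.castHom h8 (ZMod 8) u)) ?_ ?_ ?_ ?_, -(4 * k),
      ofZMod_κ_one .., ofZMod_l_one ..⟩
  · refine (Int.natCast_dvd_natCast.mpr hr16).trans (Dvd.intro (-1) ?_)
    push_cast
    ring
  · exact Dvd.intro (2 * k : ℤ) (by push_cast; ring)
  · exact Dvd.intro (-k : ℤ) (by push_cast; ring)
  · exact Dvd.intro 0 (by push_cast; ring)
  · intro u v
    simp only [map_add, choose8_add, hc]
  · intro z
    rw [castHom_scale hKd _ (Dvd.intro (k : ℤ) (by push_cast; ring))]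
    rfl
  · simp only [map_one]
    rfl
  · intro u
    simp only [hc, choose8_two]

/-- The abelianization map when all parameters are even. -/
theorem exists_hom_kleinFour {q r n : ℕ} (D : TwistData (ZMod q) (ZMod r) (ZMod n)) (hq : 2 ∣ q)
    (hκ : ∀ z, ZMod.castHom hq (ZMod 2) (D.κ z) = 0) :
    ∃ f : D.Ext →* TightRotary.KleinFour,
      f D.faceRot = (.ofAdd 1, 1) ∧ f D.vertexRot = (1, .ofAdd 1) := by
  let f₁ : D.Base →* Multiplicative (ZMod 2) :=
    { toFun := fun g => .ofAdd (ZMod.castHom hq (ZMod 2) g.fst)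
      map_one' := by simp
      map_mul' := fun a b => by
        rw [Base.fst_mul, map_add (ZMod.castHom hq (ZMod 2)), map_add (ZMod.castHom hq (ZMod 2)), hκ,
          add_zero, ofAdd_add] }
  have key : ∀ z : Multiplicative (ZMod 2), z = 1 ∨ z = .ofAdd 1 := by decide
  have h1 : (.ofAdd 1 : Multiplicative (ZMod 2)) ≠ 1 := by decide
  have hneg : ∀ z : ZMod 2, -z = z := by decide
  let f₂ : D.Ext →* Multiplicative (ZMod 2) := SemidirectProduct.lift f₁ (MonoidHom.id _) (by
    intro e
    ext g
    rcases key e with rfl | rfl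
    · simp
    · have h2 : D.action (.ofAdd 1) g = g.twist := by simp only [action]; rfl
      have h3 : f₁ g.twist = f₁ g := by
        change Multiplicative.ofAdd _ = Multiplicative.ofAdd _
        rw [Base.twist, map_add, hκ, add_zero, map_neg, hneg]
      simp [h2, h3])
  have hy : f₂ D.vertexRot = .ofAdd 1 := by
    rw [vertexRot, SemidirectProduct.lift_inl]
    change Multiplicative.ofAdd (ZMod.castHom hq (ZMod 2) 1) = _
    rw [map_one]
  have ht : f₂ D.halfTurn = .ofAdd 1 := SemidirectProduct.lift_inr ..
  refine ⟨SemidirectProduct.rightHom.prod f₂, Prod.ext D.rightHom_faceRot ?_,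
    Prod.ext D.rightHom_vertexRot hy⟩
  change f₂ D.faceRot = 1
  rw [faceRot, map_mul, map_inv, hy, ht, mul_inv_cancel]

end TwistData

/-! ### Realising the three families of types -/

namespace TightRotary

/-- A group with a tight rotary pair that has no reversing endomorphism. -/
def HasChiralPair (p q : ℕ) : Prop :=
  ∃ (G : Type) (_ : Group G) (x y : G), TightRotary x y p q ∧ Irreversible x y

theorem HasChiralPair.dual {p q : ℕ} : HasChiralPair p q → HasChiralPair q p :=
  fun ⟨G, i, _, _, h, hi⟩ => ⟨G, i, _, _, h.dual, hi.dual h⟩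

theorem HasChiralPair.exists_polyhedron {p q : ℕ} (hp : 1 < p) (hq : 1 < q) :
    HasChiralPair p q → ∃ P : AbstractPolyhedron.{0}, P.IsChiral ∧ P.IsTightOfType p q :=
  fun ⟨_, _, _, _, h, hi⟩ =>
    ⟨h.polyhedron hp hq, h.isChiral_polyhedron hp hq hi, h.isTightOfType_polyhedron hp hq⟩

/-- A mix is irreversible when a relation separating the first factor from its reverse is trivial
in the second. -/
theorem hasChiralPair_mix {G₁ G₂ Q : Type} [Group G₁] [Group G₂] [CommGroup Q] {x₁ y₁ : G₁}
    {x₂ y₂ : G₂} {p₁ q₁ p₂ q₂ : ℕ} (h₁ : TightRotary x₁ y₁ p₁ q₁) (h₂ : TightRotary x₂ y₂ p₂ q₂)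
    (f₁ : G₁ →* Q) (f₂ : G₂ →* Q) (hx : f₁ x₁ = f₂ x₂) (hy : f₁ y₁ = f₂ y₂)
    (hf : Function.Surjective f₁) (hQ : 0 < Nat.card Q)
    (hcard : Nat.card Q * (p₁.lcm p₂ * q₁.lcm q₂) = p₁ * q₁ * (p₂ * q₂)) {S M N : ℤ}
    (hr : CommRel x₁ y₁ S M N) (hn : ¬ CommRel x₁⁻¹ y₁⁻¹ S M N) (hS : (p₂ : ℤ) ∣ 2 * S)
    (hM : (q₂ : ℤ) ∣ M) (hN : (p₂ : ℤ) ∣ 2 * N) :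
    HasChiralPair (p₁.lcm p₂) (q₁.lcm q₂) := by
  obtain ⟨G, i, x, y, π₁, π₂, h, rfl, rfl, rfl, rfl, hinj⟩ :=
    exists_mix h₁ h₂ f₁ f₂ hx hy hf hQ hcard
  have e : ∀ {z : G₂} {n : ℤ} {k : ℕ}, orderOf z = k → (k : ℤ) ∣ n → z ^ n = 1 := by
    rintro z n k rfl hk
    exact orderOf_dvd_iff_zpow_eq_one.mp hk
  -- The relation is checked in each factor; in the second it collapses to `y₂ ^ S = y₂ ^ S`.
  refine ⟨G, i, x, y, h, irreversible_of_commRel h (S := S) (M := M) (N := N) (hinj _ _ ?_ ?_) ?_⟩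
  · simpa [CommRel] using hr
  · simp [e h₂.orderOf_left hS, e h₂.orderOf_right hM, e h₂.orderOf_left hN]
  · intro hc
    apply hn
    simpa using hc.map π₁

theorem hasChiralPair_of_odd {m q r : ℕ} (hm : Odd m) (hm1 : 1 < m) (hq : 0 < q)
    (hmq : m ^ 2 ∣ q) (hmr : m ∣ r) (hrq : r ∣ q) : HasChiralPair (2 * r) q := by
  obtain ⟨D, L, hK, hL⟩ := TwistData.exists_odd m hm hmq hmr hrq
  refine ⟨_, _, _, _, D.tightRotary_zmod, irreversible_of_commRel D.tightRotary_zmod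
    (D.commRel hK hL 1) (D.not_commRel_inv hK hL 1 ?_)⟩
  obtain ⟨k, rfl⟩ := (Dvd.intro _ (pow_two m).symm).trans hmq
  rw [Nat.mul_div_cancel_left _ (by omega), Ne, ZMod.intCast_zmod_eq_zero_iff_dvd]
  have hk : 0 < k := Nat.pos_of_mul_pos_left hq
  intro hd
  have hd' : m * k ∣ 2 * k := by exact_mod_cast (by simpa using hd : ((m * k : ℕ) : ℤ) ∣ 2 * k)
  have := Nat.le_of_dvd two_pos (Nat.dvd_of_mul_dvd_mul_right hk hd')
  obtain ⟨j, rfl⟩ := hm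
  omega

/-- Type `{2m^a, m^b}` is mixed with `{p, q}` over the group of order two. The exponent `S = pq`
trivialises the relation in the second factor and is prime to `m`, so `2S²m^(b-1)` stays nonzero
modulo `m^b`. -/
theorem hasChiralPair_even_of_odd_prime {m a b p q : ℕ} (hm : m.Prime) (hmo : Odd m) (ha : 1 ≤ a)
    (hab : a ≤ b) (hb : 2 ≤ b) (hp : Even p) (hq : Even q) (hmp : ¬ m ∣ p) (hmq : ¬ m ∣ q) :
    HasChiralPair (m ^ a * p) (m ^ b * q) := by
  obtain ⟨D, L, hK, hL⟩ := TwistData.exists_odd m hmo (pow_dvd_pow m hb) (dvd_pow_self m (by omega))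
    (pow_dvd_pow m hab)
  obtain ⟨G, i, x, y, f, h, hx, hy⟩ := exists_of_even hp hq
  have hcp : ∀ n, Nat.Coprime (m ^ n) p := fun n =>
    ((Nat.Prime.coprime_iff_not_dvd hm).mpr hmp).pow_left n
  have hcq : ∀ n, Nat.Coprime (m ^ n) q := fun n =>
    ((Nat.Prime.coprime_iff_not_dvd hm).mpr hmq).pow_left n
  have hlp : (2 * m ^ a).lcm p = m ^ a * p := by
    refine Nat.dvd_antisymm (Nat.lcm_dvd ?_ (Dvd.intro_left _ rfl))
      ((hcp a).mul_dvd_of_dvd_of_dvd ((Dvd.intro_left 2 rfl).trans (Nat.dvd_lcm_left _ _))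
        (Nat.dvd_lcm_right _ _))
    rw [mul_comm]
    exact Nat.mul_dvd_mul_left _ hp.two_dvd
  have hlq : (m ^ b).lcm q = m ^ b * q := (hcq b).lcm_eq_mul
  have hf : Function.Surjective (SemidirectProduct.rightHom (φ := D.action)) :=
    SemidirectProduct.rightHom_surjective
  have hrel := D.commRel hK hL ((p * q : ℕ) : ℤ)
  have hnrel := D.not_commRel_inv hK hL ((p * q : ℕ) : ℤ) ?_
  · have := hasChiralPair_mix D.tightRotary_zmod h (Q := Multiplicative (ZMod 2))
      SemidirectProduct.rightHom ((MonoidHom.fst _ _).comp f)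
      (by rw [D.rightHom_faceRot]; simp [hx]) (by rw [D.rightHom_vertexRot]; simp [hy]) hf (by simp)
      (by rw [hlp, hlq]; simp; ring) hrel hnrel
      (by push_cast; exact Dvd.intro (2 * q : ℤ) (by ring))
      (by push_cast; exact Dvd.intro (-(p * (p * q * (m ^ b / m : ℕ))) : ℤ) (by push_cast; ring))
      (by push_cast; exact Dvd.intro (2 * q * (p * q * L) : ℤ) (by ring))
    rwa [hlp, hlq] at this
  · obtain ⟨c, rfl⟩ : ∃ c, b = c + 1 := ⟨b - 1, by omega⟩
    rw [pow_succ, Nat.mul_div_cancel _ hm.pos, Ne, ZMod.intCast_zmod_eq_zero_iff_dvd]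
    intro hd
    have hd' : m * m ^ c ∣ 2 * (p * q * (p * q)) * m ^ c := by
      rw [mul_comm m, mul_assoc 2]
      exact_mod_cast hd
    have h2 := Nat.dvd_of_mul_dvd_mul_right (pow_pos hm.pos c) hd'
    have h3 : ¬ m ∣ 2 := fun h2 => by
      have := (Nat.prime_dvd_prime_iff_eq hm Nat.prime_two).mp h2
      subst this
      exact absurd hmo (by decide)
    simp only [hm.dvd_mul, h3, hmp, hmq, or_self] at h2

/-- Type `{2^a, 2^b}` is mixed with `{2p, 2q}` over the Klein four-group. As `S = pq` is odd, `2S² ·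
2^(b-2)` is an odd multiple of `2^(b-1)`, nonzero modulo `2^b`. -/
theorem hasChiralPair_of_two {a b p q : ℕ} (ha : 3 ≤ a) (hb : 5 ≤ b) (hab : a ≤ b) (hp : Odd p)
    (hq : Odd q) : HasChiralPair (2 ^ a * p) (2 ^ b * q) := by
  obtain ⟨c, rfl⟩ : ∃ c, a = c + 1 := ⟨a - 1, by omega⟩
  obtain ⟨d, rfl⟩ : ∃ d, b = d + 2 := ⟨b - 2, by omega⟩
  obtain ⟨D, L, hK, hL⟩ := TwistData.exists_four (q := 2 ^ (d + 2)) (r := 2 ^ c)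
    (pow_dvd_pow 2 hb : 2 ^ 5 ∣ 2 ^ (d + 2)) (pow_dvd_pow 2 (by omega) : 2 ^ 2 ∣ 2 ^ c)
    (by rw [← pow_succ']; exact pow_dvd_pow 2 hab)
  have hK4 : 2 ^ (d + 2) / 4 = 2 ^ d := by
    rw [pow_add]; exact Nat.mul_div_cancel _ (by norm_num)
  rw [hK4] at hK
  obtain ⟨G, i, x, y, f, h, hx, hy⟩ := exists_of_even (even_two_mul p) (even_two_mul q)
  have h2q : 2 ∣ 2 ^ (d + 2) := dvd_pow_self 2 (by omega)
  have hdK : 2 ∣ 2 ^ d := dvd_pow_self 2 (by omega)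
  obtain ⟨g, hgx, hgy⟩ := D.exists_hom_kleinFour h2q fun z => by
    obtain ⟨n, rfl⟩ := ZMod.intCast_surjective z
    have e : (n : ZMod 4) = n • 1 := by simp
    rw [e, map_zsmul, hK, map_zsmul, map_intCast,
      (ZMod.intCast_zmod_eq_zero_iff_dvd _ _).mpr (by exact_mod_cast hdK), smul_zero]
  have hcop : ∀ (n : ℕ) {k : ℕ}, Odd k → Nat.Coprime (2 ^ n) k := fun n k hk =>
    (Nat.coprime_two_left.mpr hk).pow_left n
  have hl : ∀ (n : ℕ) {k : ℕ}, Odd k → (2 ^ (n + 1)).lcm (2 * k) = 2 ^ (n + 1) * k :=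
    fun n k hk => by rw [pow_succ', Nat.lcm_mul_left, (hcop n hk).lcm_eq_mul, mul_assoc]
  have hlp := hl c hp
  have hlq := hl (d + 1) hq
  rw [pow_succ' 2 c] at hlp
  have hrel := D.commRel hK hL ((p * q : ℕ) : ℤ)
  have hnrel := D.not_commRel_inv hK hL ((p * q : ℕ) : ℤ) ?_
  · obtain ⟨e, he⟩ := hdK
    have := hasChiralPair_mix D.tightRotary_zmod h g f (hgx.trans hx.symm) (hgy.trans hy.symm)
      (surjective_of_generators g hgx hgy) (by rw [card_kleinFour]; norm_num)
      (by rw [hlp, hlq, card_kleinFour]; ring) hrel hnrel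
      (by push_cast; exact Dvd.intro (q : ℤ) (by ring))
      (by rw [he]; push_cast; exact Dvd.intro (-(p * (p * q * e)) : ℤ) (by ring))
      (by push_cast; exact Dvd.intro (q * (p * q * L) : ℤ) (by ring))
    rwa [hlp, hlq, ← pow_succ'] at this
  · rw [Ne, ZMod.intCast_zmod_eq_zero_iff_dvd]
    intro hd
    have hd' : 2 * (2 ^ d * 2) ∣ 2 * (2 ^ d * (p * q * (p * q))) := by
      rw [show 2 * (2 ^ d * 2) = 2 ^ (d + 2) by ring, mul_comm (2 ^ d)]
      exact_mod_cast hd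
    have h2 := Nat.dvd_of_mul_dvd_mul_left (by positivity)
      (Nat.dvd_of_mul_dvd_mul_left two_pos hd')
    exact absurd ((hp.mul hq).mul (hp.mul hq)) (Nat.not_odd_iff_even.mpr (even_iff_two_dvd.mpr h2))

theorem hasChiralPair_of_conditions {p q : ℕ} (hp : 0 < p) (hq : 0 < q)
    (h : (Odd q ∧ Even p ∧ p ∣ 2 * q ∧ ∃ m : ℕ, m.Prime ∧ Odd m ∧ m ∣ p ∧ m ^ 2 ∣ q) ∨
      (Even p ∧ Even q ∧ ∃ m : ℕ, m.Prime ∧ Odd m ∧ m ∣ p ∧ m ^ 2 ∣ q) ∨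
      (8 ∣ p ∧ 32 ∣ q)) : HasChiralPair p q := by
  have hexp : ∀ {m k n : ℕ}, m.Prime → ¬ m ∣ n → ∀ {c}, m ^ c ∣ m ^ k * n → c ≤ k := by
    intro m k n hm hn c hc
    have hcop : Nat.Coprime (m ^ c) n := ((Nat.Prime.coprime_iff_not_dvd hm).mpr hn).pow_left c
    exact (Nat.pow_dvd_pow_iff_le_right hm.one_lt).mp (hcop.dvd_of_dvd_mul_right hc)
  rcases h with ⟨-, hpe, hpq, m, hm, hmo, hmp, hmq⟩ | ⟨hpe, hqe, m, hm, hmo, hmp, hmq⟩ | ⟨h8, h32⟩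
  · obtain ⟨r, rfl⟩ := hpe.two_dvd
    have hmr : m ∣ r := (Nat.Coprime.dvd_mul_left
      (Nat.coprime_two_right.mpr hmo)).mp hmp
    exact hasChiralPair_of_odd hmo hm.one_lt hq hmq hmr (Nat.dvd_of_mul_dvd_mul_left two_pos hpq)
  · obtain ⟨a, p', hp', rfl⟩ := Nat.exists_eq_pow_mul_and_not_dvd hp.ne' m hm.ne_one
    obtain ⟨b, q', hq', rfl⟩ := Nat.exists_eq_pow_mul_and_not_dvd hq.ne' m hm.ne_one
    have ha : 1 ≤ a := hexp hm hp' (by rwa [pow_one])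
    have hb : 2 ≤ b := hexp hm hq' hmq
    have hev : ∀ {n k : ℕ}, Even (m ^ n * k) → Even k := fun {n k} hk =>
      (Nat.even_mul.mp hk).resolve_left (Nat.not_even_iff_odd.mpr hmo.pow)
    -- If `b ≤ a`, then `a ≥ 2` as well, so the construction applies to the reversed type and is
    -- dualised.
    rcases le_total a b with hab | hab
    · exact hasChiralPair_even_of_odd_prime hm hmo ha hab hb (hev hpe) (hev hqe) hp' hq'
    · exact (hasChiralPair_even_of_odd_prime hm hmo (by omega) hab (by omega) (hev hqe) (hev hpe)
        hq' hp').dual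
  · obtain ⟨a, p', hp', rfl⟩ := Nat.exists_eq_pow_mul_and_not_dvd hp.ne' 2 (by norm_num)
    obtain ⟨b, q', hq', rfl⟩ := Nat.exists_eq_pow_mul_and_not_dvd hq.ne' 2 (by norm_num)
    have ha : 3 ≤ a := hexp Nat.prime_two hp' h8
    have hb : 5 ≤ b := hexp Nat.prime_two hq' h32
    have hod : ∀ {k : ℕ}, ¬ 2 ∣ k → Odd k := fun hk => by
      rwa [← Nat.not_even_iff_odd, even_iff_two_dvd]
    rcases le_total a b with hab | hab
    · exact hasChiralPair_of_two ha hb hab (hod hp') (hod hq')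
    · exact (hasChiralPair_of_two (by omega) (by omega) hab (hod hq') (hod hp')).dual

end TightRotary

theorem mainTheorem2 (p q : ℕ) (hp : 0 < p) (hq : 0 < q)
    (h : (Odd q ∧ Even p ∧ p ∣ 2 * q ∧ ∃ m : ℕ, m.Prime ∧ Odd m ∧ m ∣ p ∧ m ^ 2 ∣ q) ∨
      (Even p ∧ Even q ∧ ∃ m : ℕ, m.Prime ∧ Odd m ∧ m ∣ p ∧ m ^ 2 ∣ q) ∨
      (8 ∣ p ∧ 32 ∣ q)) :
    (∃ P : AbstractPolyhedron.{0}, P.IsChiral ∧ P.IsTightOfType p q) ∧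
    (∃ P : AbstractPolyhedron.{0}, P.IsChiral ∧ P.IsTightOfType q p) := by
  have hpair := TightRotary.hasChiralPair_of_conditions hp hq h
  have hlt : 1 < p ∧ 1 < q := by
    have key : ∀ {d n : ℕ}, 1 < d → 0 < n → d ∣ n → 1 < n := fun hd hn hdn =>
      hd.trans_le (Nat.le_of_dvd hn hdn)
    rcases h with ⟨-, -, -, m, hm, -, hmp, hmq⟩ | ⟨-, -, m, hm, -, hmp, hmq⟩ | ⟨h8, h32⟩
    · exact ⟨key hm.one_lt hp hmp, key (Nat.one_lt_pow two_ne_zero hm.one_lt) hq hmq⟩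
    · exact ⟨key hm.one_lt hp hmp, key (Nat.one_lt_pow two_ne_zero hm.one_lt) hq hmq⟩
    · exact ⟨key (by norm_num) hp h8, key (by norm_num) hq h32⟩
  exact ⟨hpair.exists_polyhedron hlt.1 hlt.2, hpair.dual.exists_polyhedron hlt.2 hlt.1⟩
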